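/- **Setting.** Let $K$ be an even positive integer, $N_{\rm n},N_{\rm f}\ge 1$ integers, $\Omega_{\rm p},\Omega_{\rm n},\Omega_{\rm f},I,\mathscr N_0,B,T,\theta>0$, and $0<a_{\rm s}<a_{\rm w}$ with $a_{\rm s}+a_{\rm w}=2/K$. Put $\mathcal B=2B/K$, $\hat I=I/(\mathscr N_0\mathcal B)$, $\Omega=\Omega_{\rm n}\Omega_{\rm f}/(\Omega_{\rm n}+\Omega_{\rm f})$ and $\nu=\theta T\mathcal B/\ln 2$, and assume that $\nu$ is not an integer. Let $\hat h_{\rm p}$, $\hat h_{{\rm n},i}$ $(1\le i\le N_{\rm n})$ and $\hat h_{{\rm f},i}$ $(1\le i\le N_{\rm f})$ be independent $\mathcal{CN}(0,1)$ random variables, and let $g_{\rm p}=\Omega_{\rm p}|\hat h_{\rm p}|^2$, $g_{\rm n}=\sum_i\Omega_{\rm n}|\hat h_{{\rm n},i}|^2$, $g_{\rm f}=\sum_i\Omega_{\rm f}|\hat h_{{\rm f},i}|^2$. The weak user has gain $g_{\rm w}=\min\{g_{\rm n},g_{\rm f}\}$; with $X_{\rm w}=g_{\rm w}/g_{\rm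 p}$ its SINR is $\gamma_{\rm w}=a_{\rm w}\hat I X_{\rm w}/(1+a_{\rm s}\hat I X_{\rm w})$ and its effective rate is $R_{\rm w}=-\frac1\nu\log_2\mathbb E[(1+\gamma_{\rm w})^{-\nu}]$. **The G-function.** For $x,y>0$ the extended generalized bivariate Meijer G-function with all orders equal to $1$ is $$\mathcal G^{1,1:1,1:1,1}_{1,1:1,1:1,1}\left(\begin{smallmatrix}a_1\\b_1\end{smallmatrix}\Big|\begin{smallmatrix}a_2\\b_2\end{smallmatrix}\Big|\begin{smallmatrix}a_3\\b_3\end{smallmatrix}\Big|x,y\right)=\frac1{(2\pi i)^2}\int_{L}\int_{L_s}\Phi_1(s+t)\,\Phi_2(s)\,\Phi_3(t)\,x^{-s}y^{-t}\,dt\,ds,\qquad \Phi_k(z)=\Gamma(b_k+z)\,\Gamma(1-a_k-z),$$ where $L$ runs from $-i\infty$ to $+i\infty$ and separates the poles of $\Gamma(b_2+s)$ (on its left) from those of $\Gamma(1-a_2-s)$ (on its right), and, for each $s\in L$, $L_s$ is a vertical line in the $t$-plane that has the poles of $\Gamma(b_3+t)$ and $\Gamma(b_1+s+t)$ on its left and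 those of $\Gamma(1-a_3-t)$ and $\Gamma(1-a_1-s-t)$ on its right. Here $L$ is a vertical line with loops around the finitely many poles of $\Phi_2$ on its wrong side. **Theorem.** All the G-functions below are well defined (such contours exist, the integrals converge absolutely, and the value does not depend on the contours), the numbers $T_3$ below are real, the sum in the bracket is positive, and $$R_{\rm w}=-\frac1\nu\log_2\left[T_3(N_{\rm n},N_{\rm f},\Omega_{\rm n},\Omega_{\rm f})+T_3(N_{\rm f},N_{\rm n},\Omega_{\rm f},\Omega_{\rm n})\right],$$ where $$T_3(\alpha_1,\alpha_2,\beta_1,\beta_2)=\sum_{\tau=0}^{\alpha_2-1}\frac{\Omega_{\rm p}^{\alpha_1+\tau}\,(2\hat I/K)^{-(\alpha_1+\tau)}}{\Gamma(\alpha_1)\Gamma(\nu)\Gamma(-\nu)\,\beta_1^{\alpha_1}\beta_2^{\tau}\,\tau!}\;\mathcal G^{1,1:1,1:1,1}_{1,1:1,1:1,1}\left(\begin{smallmatrix}1-(\alpha_1+\tau)\\ \nu-(\alpha_1+\tau)\end{smallmatrix}\Big|\begin{smallmatrix}1+\nu\\0\end{smallmatrix}\Big|\begin{smallmatrix}-(\alpha_1+\tau)\\0\end{smallmatrix}\Big|\frac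 K2a_{\rm s},\frac{K\Omega_{\rm p}}{2\Omega\hat I}\right).$$ -/

import Mathlib

open MeasureTheory ProbabilityTheory

noncomputable section

/-! ### The extended generalized bivariate Meijer G-function -/

/-- One block of Meijer parameters of order `(m, n; p, q)`:
`aN = a₁, …, aₙ`, `aP = aₙ₊₁, …, a_p`, `bM = b₁, …, b_m`, `bQ = b_{m+1}, …, b_q`. -/
structure MeijerBlock where
  aN : List ℂ
  aP : List ℂ
  bM : List ℂ
  bQ : List ℂ

namespace MeijerBlock

/-- `Φ(s) = ∏_{j ≤ m} Γ(b_j + s) ∏_{j ≤ n} Γ(1 - a_j - s) /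
  (∏_{j > n} Γ(a_j + s) ∏_{j > m} Γ(1 - b_j - s))`. -/
def kernel (P : MeijerBlock) (s : ℂ) : ℂ :=
  (P.bM.map fun b => Complex.Gamma (b + s)).prod *
      (P.aN.map fun a => Complex.Gamma (1 - a - s)).prod /
    ((P.aP.map fun a => Complex.Gamma (a + s)).prod *
      (P.bQ.map fun b => Complex.Gamma (1 - b - s)).prod)

/-- The poles of the factors `Γ(b_j + s)`, `j ≤ m`. -/
def leftPoles (P : MeijerBlock) : Set ℂ := {p | ∃ b ∈ P.bM, ∃ k : ℕ, p = -b - k}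

/-- The poles of the factors `Γ(1 - a_j - s)`, `j ≤ n`. -/
def rightPoles (P : MeijerBlock) : Set ℂ := {p | ∃ a ∈ P.aN, ∃ k : ℕ, p = 1 - a + k}

end MeijerBlock

/-- Contours for the iterated Mellin–Barnes integral `∫ ds ∫ dt`. The `s`-contour is the upward line
`Re s = c` deformed so that it separates the left from the right poles of the `s`-block: it is the
cycle made of that line and of circles of radius `r` around the finitely many poles that are on the
wrong side of the line. For `s` on it, the `t`-contour is the upward line `Re t = d s`. -/
structure BarnesContour where
  c : ℝ
  r : ℝ
  d : ℂ → ℝ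

namespace BarnesContour

variable (C : BarnesContour) (P₁ P₂ P₃ : MeijerBlock) (x y : ℝ)

/-- The left poles of the `s`-block to the right of the line `Re s = c`. -/
def wrongLeft : Set ℂ := {p | p ∈ P₂.leftPoles ∧ C.c < p.re}

/-- The right poles of the `s`-block to the left of the line `Re s = c`. -/
def wrongRight : Set ℂ := {p | p ∈ P₂.rightPoles ∧ p.re < C.c}

/-- The points of the `s`-contour. -/
def support : Set ℂ :=
  {s | s.re = C.c ∨ ∃ p ∈ C.wrongLeft P₂ ∪ C.wrongRight P₂, dist s p = C.r}

/-- The contours separate the left from the right poles of all the Gamma factors of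
`Φ₁(s + t) Φ₂(s) Φ₃(t)`. -/
structure Admissible : Prop where
  r_pos : 0 < C.r
  disjoint : Disjoint P₂.leftPoles P₂.rightPoles
  line : ∀ p ∈ P₂.leftPoles ∪ P₂.rightPoles, p.re ≠ C.c
  circle_line : ∀ p ∈ C.wrongLeft P₂ ∪ C.wrongRight P₂, C.r < |p.re - C.c|
  circle_pole : ∀ p ∈ C.wrongLeft P₂ ∪ C.wrongRight P₂,
    ∀ q ∈ P₂.leftPoles ∪ P₂.rightPoles, q ≠ p → C.r < dist q p
  left_t : ∀ s ∈ C.support P₂, ∀ p ∈ P₃.leftPoles, p.re < C.d s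
  right_t : ∀ s ∈ C.support P₂, ∀ p ∈ P₃.rightPoles, C.d s < p.re
  left_st : ∀ s ∈ C.support P₂, ∀ p ∈ P₁.leftPoles, p.re < s.re + C.d s
  right_st : ∀ s ∈ C.support P₂, ∀ p ∈ P₁.rightPoles, s.re + C.d s < p.re

/-- `u ↦ Φ₁(s + t) Φ₃(t) y⁻ᵗ` at `t = d s + i u`. -/
def innerIntegrand (s : ℂ) (u : ℝ) : ℂ :=
  P₁.kernel (s + (C.d s + u * Complex.I)) * P₃.kernel (C.d s + u * Complex.I) *
    (y : ℂ) ^ (-(C.d s + u * Complex.I))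

/-- `Φ₂(s) x⁻ˢ (2πi)⁻¹ ∫ Φ₁(s + t) Φ₃(t) y⁻ᵗ dt`. -/
def outerIntegrand (s : ℂ) : ℂ :=
  P₂.kernel s * (x : ℂ) ^ (-s) *
    ((2 * Real.pi : ℂ)⁻¹ * ∫ u : ℝ, C.innerIntegrand P₁ P₃ y s u)

/-- All the integrals that make up `value` converge absolutely. -/
structure Converges : Prop where
  inner : ∀ s ∈ C.support P₂, Integrable (C.innerIntegrand P₁ P₃ y s)
  line : Integrable fun u : ℝ => C.outerIntegrand P₁ P₂ P₃ x y (C.c + u * Complex.I)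
  circle : ∀ p ∈ C.wrongLeft P₂ ∪ C.wrongRight P₂,
    CircleIntegrable (C.outerIntegrand P₁ P₂ P₃ x y) p C.r

/-- The contribution of the circle around `p`, oriented counterclockwise. -/
def loop (p : ℂ) : ℂ :=
  (2 * Real.pi * Complex.I)⁻¹ * (∮ z in C(p, C.r), C.outerIntegrand P₁ P₂ P₃ x y z)

/-- `(2πi)⁻² ∫ ∫ Φ₁(s + t) Φ₂(s) Φ₃(t) x⁻ˢ y⁻ᵗ dt ds` along the contours. A left pole on the wrong
side of the line is circled counterclockwise, a right pole clockwise. -/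
def value : ℂ :=
  (2 * Real.pi : ℂ)⁻¹ * (∫ u : ℝ, C.outerIntegrand P₁ P₂ P₃ x y (C.c + u * Complex.I))
    + (∑ᶠ p ∈ C.wrongLeft P₂, C.loop P₁ P₂ P₃ x y p)
    - (∑ᶠ p ∈ C.wrongRight P₂, C.loop P₁ P₂ P₃ x y p)

end BarnesContour

/-- `v` is the value at `(x, y)` of the extended generalized bivariate Meijer G-function with parameter
blocks `P₁` (for `s + t`), `P₂` (for `s`), `P₃` (for `t`): admissible contours exist, and along each
of them the double Mellin–Barnes integral converges to `v`. -/
def IsEGBMGF (P₁ P₂ P₃ : MeijerBlock) (x y : ℝ) (v : ℂ) : Prop :=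
  (∃ C : BarnesContour, C.Admissible P₁ P₂ P₃) ∧
    ∀ C : BarnesContour, C.Admissible P₁ P₂ P₃ →
      C.Converges P₁ P₂ P₃ x y ∧ C.value P₁ P₂ P₃ x y = v

open Classical in
/-- The extended generalized bivariate Meijer G-function (`0` where it is not defined). -/
def egbmgf (P₁ P₂ P₃ : MeijerBlock) (x y : ℝ) : ℂ :=
  if h : ∃ v, IsEGBMGF P₁ P₂ P₃ x y v then h.choose else 0

/-- The block of order `(1, 1; 1, 1)` with upper parameter `a` and lower parameter `b`. -/
def block11 (a b : ℝ) : MeijerBlock := ⟨[(a : ℂ)], [], [(b : ℂ)], []⟩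

/-! ### The system -/

/-- The circularly symmetric complex Gaussian law `𝒞𝒩(0, 1)`. -/
def stdComplexGaussian : Measure ℂ :=
  ((gaussianReal 0 (1 / 2)).prod (gaussianReal 0 (1 / 2))).map Complex.measurableEquivRealProd.symm

/-- Parameters of a user pair of the underlay NOMA downlink: number `K` of users, numbers `Nn`, `Nf` of
antennas of the near and the far user, path losses `Ωp`, `Ωn`, `Ωf`, peak interference power `I`,
noise density `N₀`, total bandwidth `B`, block length `T`, delay exponent `θ`, power allocation
coefficients `aₛ`, `a_w` of the strong and the weak user. -/
structure NOMAParams where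
  K : ℕ
  Nn : ℕ
  Nf : ℕ
  Ωp : ℝ
  Ωn : ℝ
  Ωf : ℝ
  I : ℝ
  N₀ : ℝ
  B : ℝ
  T : ℝ
  θ : ℝ
  as : ℝ
  aw : ℝ
  K_pos : 0 < K
  K_even : Even K
  Nn_pos : 1 ≤ Nn
  Nf_pos : 1 ≤ Nf
  Ωp_pos : 0 < Ωp
  Ωn_pos : 0 < Ωn
  Ωf_pos : 0 < Ωf
  I_pos : 0 < I
  N₀_pos : 0 < N₀
  B_pos : 0 < B
  T_pos : 0 < T
  θ_pos : 0 < θ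
  as_pos : 0 < as
  as_lt_aw : as < aw
  as_add_aw : as + aw = 2 / K

namespace NOMAParams

variable (S : NOMAParams)

/-- The bandwidth of the user pair. -/
def pairBandwidth : ℝ := 2 * S.B / S.K

/-- `ν = θ T 𝓑 / ln 2`. -/
def ν : ℝ := S.θ * S.T * S.pairBandwidth / Real.log 2

/-- `Î = I / (N₀ 𝓑)`. -/
def Ihat : ℝ := S.I / (S.N₀ * S.pairBandwidth)

/-- `Ω = Ωn Ωf / (Ωn + Ωf)`. -/
def Ω : ℝ := S.Ωn * S.Ωf / (S.Ωn + S.Ωf)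

/-- First parameter block of the G-function in the `τ`-th term of `T₃`, where `a = α₁ + τ`. -/
def blk₁ (a : ℕ) : MeijerBlock := block11 (1 - a) (S.ν - a)

/-- Its second parameter block. -/
def blk₂ : MeijerBlock := block11 (1 + S.ν) 0

/-- Its third parameter block. -/
def blk₃ (a : ℕ) : MeijerBlock := block11 (-a) 0

/-- Its first argument. -/
def argX : ℝ := S.K / 2 * S.as

/-- Its second argument. -/
def argY : ℝ := S.K * S.Ωp / (2 * S.Ω * S.Ihat)

def T₃ (α₁ α₂ : ℕ) (β₁ β₂ : ℝ) : ℂ :=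
  ∑ τ ∈ Finset.range α₂,
    ((S.Ωp ^ (α₁ + τ) * ((2 * S.Ihat / S.K) ^ (α₁ + τ))⁻¹ /
      (Real.Gamma α₁ * Real.Gamma S.ν * Real.Gamma (-S.ν) * β₁ ^ α₁ * β₂ ^ τ * τ.factorial) : ℝ) : ℂ) *
    egbmgf (S.blk₁ (α₁ + τ)) S.blk₂ (NOMAParams.blk₃ (α₁ + τ)) S.argX S.argY

end NOMAParams

/-- The normalized fading coefficients of the links from the secondary transmitter to the primary
receiver (`hp`) and to the antennas of the near (`hn`) and the far (`hf`) user: independent, with law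
`𝒞𝒩(0, 1)` (Rayleigh fading). -/
structure RayleighFading (S : NOMAParams) {E : Type*} [MeasurableSpace E] (μ : Measure E) where
  hp : E → ℂ
  hn : Fin S.Nn → E → ℂ
  hf : Fin S.Nf → E → ℂ
  law_hp : HasLaw hp stdComplexGaussian μ
  law_hn : ∀ i, HasLaw (hn i) stdComplexGaussian μ
  law_hf : ∀ i, HasLaw (hf i) stdComplexGaussian μ
  indep : iIndepFun (fun j : Unit ⊕ (Fin S.Nn ⊕ Fin S.Nf) =>
    Sum.elim (fun _ => hp) (Sum.elim hn hf) j) μ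

namespace RayleighFading

variable {S : NOMAParams} {E : Type*} [MeasurableSpace E] {μ : Measure E} (F : RayleighFading S μ)

/-- Channel gain of the interference link. -/
def gp (ω : E) : ℝ := ‖(Real.sqrt S.Ωp : ℂ) * F.hp ω‖ ^ 2

/-- Combined channel gain of the near user. -/
def gn (ω : E) : ℝ := ∑ i, ‖(Real.sqrt S.Ωn : ℂ) * F.hn i ω‖ ^ 2

/-- Combined channel gain of the far user. -/
def gf (ω : E) : ℝ := ∑ i, ‖(Real.sqrt S.Ωf : ℂ) * F.hf i ω‖ ^ 2

/-- Channel gain of the weak user, the user of the pair with the smaller gain. -/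
def gw (ω : E) : ℝ := min (F.gn ω) (F.gf ω)

/-- SINR of the weak user, at transmit power `I / g_p`. -/
def γw (ω : E) : ℝ :=
  S.aw * S.I * F.gw ω / F.gp ω / (S.N₀ * S.pairBandwidth + S.as * S.I * F.gw ω / F.gp ω)

/-- Effective rate of the weak user, `-(1/ν) log₂ 𝔼[(1 + γ_w)^(-ν)]`. -/
def Rw : ℝ := -1 / S.ν * Real.logb 2 (∫ ω, (1 + F.γw ω) ^ (-S.ν) ∂μ)

end RayleighFading

end

/-! Both sides reduce to the integrals ∫₀^∞ ((w + x)/(w + 1))^ν (w + y)^(-(a+1)) dw, where x =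
`argX`, y = `argY` and a = α₁ + τ.

Probability side. The gains are gamma distributed with integer shape, so their tails are an
exponential times a polynomial. The expectation is split according to which user attains the
minimum. In terms of w = K g_p / (2 Î g_w), the quantity (1 + γ_w)^(-ν) is ((w + x)/(w + 1))^ν, and
given g_w = z the variable w is exponential with rate proportional to z. Integrating out z first
leaves powers of w + y, one integral for each monomial of the tail
(`lintegral_mul_gammaMeasure_Ioi`).

G-function side. A Parseval formula for Mellin transforms (`mellin_parseval`) identifies the inner
integral with the Mellin transform of `innerDensity` at s, whatever line is used in the t-plane
(`inner_integral`). The same formula applied to the outer integral leaves, at X = x/w, the Barnes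
integral of Γ(s) Γ(-ν - s) X^(-s). Since -ν < 0, no vertical line separates the poles, so Mellin
inversion does not apply directly. On any line that avoids the poles the integral is Γ(-ν) (1 + X)^ν
minus finitely many residue terms (`barnesLine_eq`), and the loops of the contour restore exactly
these terms. Hence the value does not depend on the contour (`converges_and_value`). Its factor Γ(ν)
Γ(-ν) is cancelled by the normalization of T₃.

No contour is ever shifted. In `barnesLine_eq`, differentiation in X raises μ and c by one and
removes one misplaced left pole, the limit at X = 0 fixes the constant of integration, the
reflection X ↦ 1/X exchanges left and right poles, and the base case is Mellin inversion in the
strip 0 < c < μ. -/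

noncomputable section

open Complex Set Filter Topology

/-! ### The kernel `Γ(s) Γ(μ - s)` on vertical lines -/

/-- `Γ(s) Γ(μ - s)`. -/
def gammaKernel (μ : ℝ) (s : ℂ) : ℂ := Gamma s * Gamma (μ - s)

/-- The line `Re s = c` avoids the poles of `Γ(s) Γ(μ - s)`. -/
def AvoidsPoles (μ c : ℝ) : Prop := (∀ k : ℕ, c ≠ -k) ∧ ∀ k : ℕ, c ≠ μ + k

lemma AvoidsPoles.succ {μ c : ℝ} (h : AvoidsPoles μ c) : AvoidsPoles (μ + 1) (c + 1) := by
  refine ⟨fun k hk => h.1 (k + 1) ?_, fun k hk => h.2 k ?_⟩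
  · push_cast; linarith
  · linarith

lemma AvoidsPoles.succ_left {μ c : ℝ} (h : AvoidsPoles μ c) : AvoidsPoles (μ + 1) c := by
  refine ⟨h.1, fun k hk => h.2 (k + 1) ?_⟩
  push_cast; linarith

lemma AvoidsPoles.symm {μ c : ℝ} (h : AvoidsPoles μ c) : AvoidsPoles μ (μ - c) := by
  refine ⟨fun k hk => h.2 k ?_, fun k hk => h.1 k ?_⟩ <;> linarith

lemma avoidsPoles_of_mem_strip {μ c : ℝ} (h0 : 0 < c) (h1 : c < μ) : AvoidsPoles μ c := by
  refine ⟨fun k hk => ?_, fun k hk => ?_⟩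
  · have : (0 : ℝ) ≤ k := k.cast_nonneg
    linarith
  · have : (0 : ℝ) ≤ k := k.cast_nonneg
    linarith

lemma norm_Gamma_le {s : ℂ} (hs : 0 < s.re) : ‖Gamma s‖ ≤ Real.Gamma s.re := by
  rw [Gamma_eq_integral hs, Real.Gamma_eq_integral hs, GammaIntegral]
  refine (norm_integral_le_integral_norm _).trans (le_of_eq ?_)
  refine setIntegral_congr_fun measurableSet_Ioi fun x hx => ?_
  simp only [norm_mul, Complex.norm_real, Real.norm_eq_abs, abs_of_pos (Real.exp_pos _)]
  rw [norm_cpow_eq_rpow_re_of_pos hx]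
  simp

lemma gammaKernel_symm (μ : ℝ) (s : ℂ) : gammaKernel μ (μ - s) = gammaKernel μ s := by
  simp [gammaKernel, mul_comm]

lemma gammaKernel_succ (μ : ℝ) {s : ℂ} (hs : s ≠ 0) :
    gammaKernel (μ + 1) (s + 1) = s * gammaKernel μ s := by
  simp only [gammaKernel, Gamma_add_one s hs]
  push_cast
  rw [show (μ : ℂ) + 1 - (s + 1) = μ - s by ring]
  ring

lemma gammaKernel_succ_left (μ : ℝ) {s : ℂ} (hs : (μ : ℂ) - s ≠ 0) :
    gammaKernel (μ + 1) s = (μ - s) * gammaKernel μ s := by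
  simp only [gammaKernel]
  push_cast
  rw [show (μ : ℂ) + 1 - s = (μ - s) + 1 by ring, Gamma_add_one _ hs]
  ring

lemma continuous_gammaKernel_line {μ c : ℝ} (h : AvoidsPoles μ c) :
    Continuous fun u : ℝ => gammaKernel μ (c + u * I) := by
  have hl : Continuous fun u : ℝ => (c : ℂ) + u * I := by fun_prop
  rw [continuous_iff_continuousAt]
  intro u
  refine ContinuousAt.mul ?_ ?_
  · refine ContinuousAt.comp (g := Gamma) (f := fun u : ℝ => (c : ℂ) + u * I) ?_ hl.continuousAt
    refine (differentiableAt_Gamma _ fun m hm => h.1 m ?_).continuousAt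
    simpa using congrArg re hm
  · refine ContinuousAt.comp (g := Gamma) (f := fun u : ℝ => (μ : ℂ) - (c + u * I)) ?_
      (by fun_prop)
    refine (differentiableAt_Gamma _ fun m hm => h.2 m ?_).continuousAt
    have := congrArg re hm
    simp at this
    linarith

/-- The two functional equations together produce the factor s (μ - s), of size u² on the line.
Dividing by it turns boundedness of the shifted kernel into quadratic decay, so Stirling's formula
is not needed. -/
lemma gammaKernel_bound_step {μ c : ℝ} (h : AvoidsPoles μ c)
    (hb : ∃ C, ∀ u : ℝ, ‖gammaKernel (μ + 2) ((c + 1 : ℝ) + u * I)‖ ≤ C) :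
    ∃ C, ∀ u : ℝ, ‖gammaKernel μ (c + u * I)‖ ≤ C * (1 + u ^ 2)⁻¹ := by
  obtain ⟨C, hC⟩ := hb
  have hc0 : c ≠ 0 := by simpa using h.1 0
  have hc1 : μ - c ≠ 0 := by
    have := h.2 0
    simp at this
    exact fun h' => this (by linarith)
  -- δ bounds |c| and |μ - c| from below and is at most 1, so b² + u² ≥ δ² (1 + u²) for both real
  -- parts b = c and b = μ - c.
  set δ : ℝ := min 1 (min |c| |μ - c|) with hδ
  have hδ0 : 0 < δ := by
    simp only [hδ, lt_min_iff]
    exact ⟨one_pos, abs_pos.2 hc0, abs_pos.2 hc1⟩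
  have key : ∀ b u : ℝ, δ ≤ |b| → δ ^ 2 * (1 + u ^ 2) ≤ ‖(b + u * I : ℂ)‖ ^ 2 := by
    intro b u hb
    have h1 : δ ≤ 1 := min_le_left _ _
    have h2 : ‖(b + u * I : ℂ)‖ ^ 2 = b ^ 2 + u ^ 2 := by
      rw [← normSq_eq_norm_sq, normSq_add_mul_I]
    rw [h2, ← sq_abs b]
    nlinarith [sq_nonneg u, mul_nonneg (sq_nonneg u) (by nlinarith : 0 ≤ 1 - δ ^ 2),
      pow_le_pow_left₀ hδ0.le hb 2]
  have hC0 : 0 ≤ C := (norm_nonneg _).trans (hC 0)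
  refine ⟨C / δ ^ 2, fun u => ?_⟩
  set s : ℂ := c + u * I with hs
  have hs0 : s ≠ 0 := fun h' => hc0 (by simpa [hs] using congrArg re h')
  have hs1 : (μ : ℂ) - s ≠ 0 := fun h' => hc1 (by simpa [hs] using congrArg re h')
  have e : gammaKernel (μ + 2) ((c + 1 : ℝ) + u * I) = s * ((μ - s) * gammaKernel μ s) := by
    rw [← gammaKernel_succ_left μ hs1, ← gammaKernel_succ _ hs0]
    congr 1
    · ring
    · simp [hs]; ring
  have hn := hC u
  rw [e, norm_mul, norm_mul] at hn
  have k1 := key c u (by simp [hδ])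
  have k2 := key (μ - c) (-u) (by simp [hδ])
  have e2 : ((μ - c : ℝ) : ℂ) + (-u : ℝ) * I = μ - s := by simp [hs]; ring
  rw [e2] at k2
  rw [← hs] at k1
  have k3 : δ ^ 2 * (1 + u ^ 2) ≤ ‖s‖ * ‖(μ : ℂ) - s‖ := by
    have hp : 0 ≤ δ ^ 2 * (1 + u ^ 2) := by positivity
    rw [neg_sq] at k2
    refine abs_le_of_sq_le_sq' ?_ (by positivity) |>.2
    rw [mul_pow ‖s‖, sq (δ ^ 2 * (1 + u ^ 2))]
    exact mul_le_mul k1 k2 hp (by positivity)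
  rw [← div_eq_mul_inv, div_div, le_div_iff₀ (by positivity)]
  calc ‖gammaKernel μ s‖ * (δ ^ 2 * (1 + u ^ 2))
      ≤ ‖gammaKernel μ s‖ * (‖s‖ * ‖(μ : ℂ) - s‖) := by gcongr
    _ ≤ C := by linarith

lemma gammaKernel_bounded_strip {μ c : ℝ} (h0 : 0 < c) (h1 : c < μ) :
    ∃ C, ∀ u : ℝ, ‖gammaKernel μ (c + u * I)‖ ≤ C := by
  refine ⟨Real.Gamma c * Real.Gamma (μ - c), fun u => ?_⟩
  rw [gammaKernel, norm_mul]
  have a1 := norm_Gamma_le (s := c + u * I) (by simpa using h0)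
  have a2 := norm_Gamma_le (s := μ - (c + u * I)) (by simpa using h1)
  simp at a1 a2
  exact mul_le_mul a1 a2 (norm_nonneg _) (Real.Gamma_pos_of_pos h0).le

/-- Passing from (μ, c) to (μ + 2, c + 1) brings the line one unit closer to the strip 0 < c < μ on
either side, so n counts the shifts needed to reach it. -/
lemma gammaKernel_bound_aux (n : ℕ) : ∀ {μ c : ℝ}, AvoidsPoles μ c → -(n : ℝ) < c → c < μ + n →
    ∃ C, ∀ u : ℝ, ‖gammaKernel μ (c + u * I)‖ ≤ C * (1 + u ^ 2)⁻¹ := by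
  induction n with
  | zero =>
    intro μ c h h0 h1
    simp at h0 h1
    exact gammaKernel_bound_step h (gammaKernel_bounded_strip (by linarith) (by linarith))
  | succ n ih =>
    intro μ c h h0 h1
    push_cast at h0 h1
    refine gammaKernel_bound_step h ?_
    have h2 : AvoidsPoles (μ + 2) (c + 1) := by
      have := h.succ.succ_left
      rwa [show μ + 1 + 1 = μ + 2 by ring] at this
    obtain ⟨C, hC⟩ := ih h2 (by linarith) (by linarith)
    refine ⟨C, fun u => (hC u).trans ?_⟩
    have hC0 : 0 ≤ C := by
      have := (norm_nonneg _).trans (hC 0)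
      simpa using this
    refine mul_le_of_le_one_right hC0 (inv_le_one_of_one_le₀ ?_)
    nlinarith [sq_nonneg u]

lemma gammaKernel_bound {μ c : ℝ} (h : AvoidsPoles μ c) :
    ∃ C, ∀ u : ℝ, ‖gammaKernel μ (c + u * I)‖ ≤ C * (1 + u ^ 2)⁻¹ := by
  obtain ⟨n, hn⟩ := exists_nat_gt (max (-c) (c - μ))
  rw [max_lt_iff] at hn
  exact gammaKernel_bound_aux n h (by linarith) (by linarith)

lemma integrable_gammaKernel_line {μ c : ℝ} (h : AvoidsPoles μ c) :
    Integrable fun u : ℝ => gammaKernel μ (c + u * I) := by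
  obtain ⟨C, hC⟩ := gammaKernel_bound h
  exact (integrable_inv_one_add_sq.const_mul C).mono'
    (continuous_gammaKernel_line h).aestronglyMeasurable (ae_of_all _ hC)

/-! ### The Mellin transform of `(1 + x) ^ (-μ)` -/

lemma locallyIntegrableOn_one_add_rpow (μ : ℝ) :
    LocallyIntegrableOn (fun x : ℝ => (((1 + x) ^ (-μ) : ℝ) : ℂ)) (Ioi 0) := by
  refine ContinuousOn.locallyIntegrableOn ?_ measurableSet_Ioi
  refine continuous_ofReal.comp_continuousOn ?_
  refine ContinuousOn.rpow_const (by fun_prop) fun x hx => Or.inl ?_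
  have : (0 : ℝ) < x := hx
  positivity

lemma mellinConvergent_one_add_rpow {μ : ℝ} {s : ℂ} (h0 : 0 < s.re) (h1 : s.re < μ) :
    MellinConvergent (fun x : ℝ => (((1 + x) ^ (-μ) : ℝ) : ℂ)) s := by
  refine mellinConvergent_of_isBigO_rpow (a := μ) (b := 0) (locallyIntegrableOn_one_add_rpow μ)
    ?_ h1 ?_ h0
  · refine Asymptotics.IsBigO.of_bound 1 ?_
    filter_upwards [eventually_gt_atTop 0] with x hx
    rw [Complex.norm_real, Real.norm_of_nonneg (by positivity), Real.norm_of_nonneg (by positivity),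
      one_mul]
    exact Real.rpow_le_rpow_of_nonpos hx (by linarith) (by linarith)
  · refine Asymptotics.IsBigO.of_bound 1 ?_
    filter_upwards [self_mem_nhdsWithin] with x hx
    have hx : 0 < x := hx
    rw [Complex.norm_real, Real.norm_of_nonneg (by positivity)]
    simp only [neg_zero, Real.rpow_zero, norm_one, mul_one]
    exact Real.rpow_le_one_of_one_le_of_nonpos (by linarith) (by linarith)

/-- The substitution t = x / (1 + x) maps (0, ∞) onto (0, 1). The change of variables holds for
non-integrable functions too, so s is arbitrary. -/
lemma mellin_one_add_rpow (μ : ℝ) (s : ℂ) :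
    mellin (fun x : ℝ => (((1 + x) ^ (-μ) : ℝ) : ℂ)) s = betaIntegral s (μ - s) := by
  have himg : (fun x : ℝ => x / (1 + x)) '' Ioi 0 = Ioo 0 1 := by
    ext t
    constructor
    · rintro ⟨x, hx, rfl⟩
      have hx : 0 < x := hx
      exact ⟨by positivity, by rw [div_lt_one (by positivity)]; linarith⟩
    · rintro ⟨ht0, ht1⟩
      have : 0 < 1 - t := by linarith
      refine ⟨t / (1 - t), div_pos ht0 this, ?_⟩
      field_simp
      ring
  have hinj : InjOn (fun x : ℝ => x / (1 + x)) (Ioi 0) := by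
    intro x hx y hy hxy
    have hx : 0 < x := hx
    have hy : 0 < y := hy
    simp only at hxy
    rw [div_eq_div_iff (by positivity) (by positivity)] at hxy
    linarith
  have hder : ∀ x ∈ Ioi (0 : ℝ), HasDerivWithinAt (fun x : ℝ => x / (1 + x)) (((1 + x) ^ 2)⁻¹)
      (Ioi 0) x := by
    intro x hx
    have hx : 0 < x := hx
    have := (hasDerivAt_id x).div ((hasDerivAt_id x).const_add 1) (by simp; positivity)
    convert! this.hasDerivWithinAt using 1
    simp
  rw [betaIntegral, intervalIntegral.integral_of_le zero_le_one, integral_Ioc_eq_integral_Ioo,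
    ← himg, integral_image_eq_integral_abs_deriv_smul measurableSet_Ioi hder hinj, mellin]
  refine setIntegral_congr_fun measurableSet_Ioi fun x hx => ?_
  have hx : 0 < x := hx
  have hx1 : 0 < 1 + x := by positivity
  have e1 : (1 : ℂ) - ((x / (1 + x) : ℝ) : ℂ) = ((1 + x)⁻¹ : ℝ) := by
    rw [← ofReal_one, ← ofReal_sub]
    congr 1
    field_simp
    ring
  simp only [smul_eq_mul]
  rw [e1, abs_of_pos (by positivity), real_smul, ofReal_cpow hx1.le]
  have hne : ((1 + x : ℝ) : ℂ) ≠ 0 := ofReal_ne_zero.2 hx1.ne'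
  have e2 : (((1 + x)⁻¹ : ℝ) : ℂ) ^ (μ - s - 1) = ((1 + x : ℝ) : ℂ) ^ (-(μ - s - 1)) := by
    rw [ofReal_inv, inv_cpow _ _ (by rw [arg_ofReal_of_nonneg hx1.le]; exact Real.pi_pos.ne),
      cpow_neg]
  have e3 : ((x / (1 + x) : ℝ) : ℂ) ^ (s - 1) =
      (x : ℂ) ^ (s - 1) * ((1 + x : ℝ) : ℂ) ^ (-(s - 1)) := by
    rw [div_eq_mul_inv, ofReal_mul, mul_cpow_ofReal_nonneg hx.le (by positivity), ofReal_inv,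
      inv_cpow _ _ (by rw [arg_ofReal_of_nonneg hx1.le]; exact Real.pi_pos.ne), cpow_neg]
  have e4 : ((((1 + x) ^ 2)⁻¹ : ℝ) : ℂ) = ((1 + x : ℝ) : ℂ) ^ (-2 : ℂ) := by
    rw [cpow_neg]
    push_cast
    norm_cast
  rw [e2, e3, e4]
  rw [show ∀ a b c d : ℂ, a * (b * c * d) = b * (a * c * d) by intros; ring,
    ← cpow_add _ _ hne, ← cpow_add _ _ hne]
  congr 2
  push_cast
  ring

lemma mellin_Gamma_mul_one_add_rpow {μ : ℝ} {s : ℂ} (h0 : 0 < s.re) (h1 : s.re < μ) :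
    mellin (fun x : ℝ => ((Real.Gamma μ * (1 + x) ^ (-μ) : ℝ) : ℂ)) s = gammaKernel μ s := by
  have := mellin_const_smul (fun x : ℝ => (((1 + x) ^ (-μ) : ℝ) : ℂ)) s (Real.Gamma μ : ℂ)
  simp only [smul_eq_mul, ← ofReal_mul] at this
  rw [this, mellin_one_add_rpow, gammaKernel,
    Gamma_mul_Gamma_eq_betaIntegral h0 (by simpa using h1)]
  simp [Gamma_ofReal]

/-! ### Barnes integrals along vertical lines -/

/-- `(2πi)⁻¹ ∫ Γ(s) Γ(μ - s) X⁻ˢ ds` along the line `Re s = c`. -/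
def barnesLine (μ c X : ℝ) : ℂ :=
  (2 * Real.pi : ℂ)⁻¹ * ∫ u : ℝ, gammaKernel μ (c + u * I) * (X : ℂ) ^ (-(c + u * I : ℂ))

lemma barnesLine_of_mem_strip {μ c X : ℝ} (h0 : 0 < c) (h1 : c < μ) (hX : 0 < X) :
    barnesLine μ c X = (Real.Gamma μ * (1 + X) ^ (-μ) : ℝ) := by
  set f : ℝ → ℂ := fun x => ((Real.Gamma μ * (1 + x) ^ (-μ) : ℝ) : ℂ) with hf
  have hm : ∀ u : ℝ, mellin f (c + u * I) = gammaKernel μ (c + u * I) := fun u =>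
    mellin_Gamma_mul_one_add_rpow (by simpa using h0) (by simpa using h1)
  have hcv : MellinConvergent f c := by
    have := (mellinConvergent_one_add_rpow (μ := μ) (s := c) (by simpa using h0)
      (by simpa using h1)).const_smul (Real.Gamma μ : ℂ)
    simpa only [smul_eq_mul, ← ofReal_mul] using this
  have hv : VerticalIntegrable (mellin f) c := by
    simp only [VerticalIntegrable, hm]
    exact integrable_gammaKernel_line (avoidsPoles_of_mem_strip h0 h1)
  have hc : ContinuousAt f X := by
    refine continuous_ofReal.continuousAt.comp ?_
    refine continuousAt_const.mul (ContinuousAt.rpow_const (by fun_prop) (Or.inl ?_))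
    positivity
  have := mellinInv_mellin_eq c f hX hcv hv hc
  simp only [mellinInv, hm] at this
  rw [← hf] at *
  change _ = f X
  rw [← this, barnesLine, real_smul]
  push_cast
  rw [one_div]
  congr 2
  ext u
  rw [smul_eq_mul, mul_comm]

/-- A bound on [a, b] that does not depend on the sign of p; it dominates X^(-s) locally uniformly
in X when differentiating under the integral. -/
lemma rpow_le_add_rpow {a b X : ℝ} (p : ℝ) (ha : 0 < a) (haX : a ≤ X) (hXb : X ≤ b) :
    X ^ p ≤ a ^ p + b ^ p := by
  have hX : 0 < X := ha.trans_le haX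
  have hb : 0 < b := hX.trans_le hXb
  rcases le_total 0 p with hp | hp
  · have := Real.rpow_le_rpow hX.le hXb hp
    have : 0 < a ^ p := by positivity
    linarith
  · have := Real.rpow_le_rpow_of_nonpos ha haX hp
    have : 0 < b ^ p := by positivity
    linarith

lemma norm_cpow_neg_line {X : ℝ} (hX : 0 < X) (c u : ℝ) :
    ‖(X : ℂ) ^ (-(c + u * I : ℂ))‖ = X ^ (-c) := by
  rw [norm_cpow_eq_rpow_re_of_pos hX]
  simp

lemma continuous_cpow_neg_line {X : ℝ} (hX : 0 < X) (c : ℝ) :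
    Continuous fun u : ℝ => (X : ℂ) ^ (-(c + u * I : ℂ)) :=
  Continuous.const_cpow (by fun_prop) (Or.inl (ofReal_ne_zero.2 hX.ne'))

lemma integrable_gammaKernel_mul_cpow {μ c X : ℝ} (h : AvoidsPoles μ c) (hX : 0 < X) :
    Integrable fun u : ℝ => gammaKernel μ (c + u * I) * (X : ℂ) ^ (-(c + u * I : ℂ)) :=
  (integrable_gammaKernel_line h).mul_bdd (c := X ^ (-c))
    (continuous_cpow_neg_line hX c).aestronglyMeasurable
    (ae_of_all _ fun u => (norm_cpow_neg_line hX c u).le)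

/-- The derivative of X^(-s) brings down -s, and s Γ(s) = Γ(s + 1) absorbs it: the pole at s = 0
disappears and the line moves with the shifted parameter. -/
lemma hasDerivAt_barnesLine {μ c X : ℝ} (h : AvoidsPoles μ c) (hX : 0 < X) :
    HasDerivAt (barnesLine μ c) (-barnesLine (μ + 1) (c + 1) X) X := by
  obtain ⟨C, hC⟩ := gammaKernel_bound h.succ
  have hC0 : 0 ≤ C := by simpa using (norm_nonneg _).trans (hC 0)
  have hc0 : c ≠ 0 := by simpa using h.1 0
  set M : ℝ := (X / 2) ^ (-(c + 1)) + (X / 2 + X) ^ (-(c + 1))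
  have hball : ∀ x ∈ Metric.ball X (X / 2), X / 2 ≤ x ∧ x ≤ X / 2 + X := by
    intro x hx
    rw [Metric.mem_ball, Real.dist_eq, abs_lt] at hx
    constructor <;> linarith
  have main := hasDerivAt_integral_of_dominated_loc_of_deriv_le (μ := volume) (𝕜 := ℝ)
    (F := fun (x : ℝ) (u : ℝ) => gammaKernel μ (c + u * I) * (x : ℂ) ^ (-(c + u * I : ℂ)))
    (F' := fun (x : ℝ) (u : ℝ) => -(gammaKernel (μ + 1) ((c + 1 : ℝ) + u * I) *
      (x : ℂ) ^ (-((c + 1 : ℝ) + u * I : ℂ))))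
    (x₀ := X) (bound := fun u => C * (1 + u ^ 2)⁻¹ * M) (s := Metric.ball X (X / 2))
    (Metric.ball_mem_nhds X (by positivity)) ?_ (integrable_gammaKernel_mul_cpow h hX) ?_ ?_
    ((integrable_inv_one_add_sq.const_mul C).mul_const M) ?_
  · have := main.2.const_mul (2 * Real.pi : ℂ)⁻¹
    rw [integral_neg, mul_neg] at this
    exact this
  · filter_upwards [Metric.ball_mem_nhds X (half_pos hX)] with x hx
    have hx0 : 0 < x := (half_pos hX).trans_le (hball x hx).1
    exact (integrable_gammaKernel_mul_cpow h hx0).aestronglyMeasurable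
  · exact (integrable_gammaKernel_mul_cpow h.succ hX).neg.aestronglyMeasurable
  · refine ae_of_all _ fun u x hx => ?_
    have hx0 : 0 < x := (half_pos hX).trans_le (hball x hx).1
    rw [norm_neg, norm_mul, norm_cpow_neg_line hx0]
    exact mul_le_mul (hC u) (rpow_le_add_rpow _ (half_pos hX) (hball x hx).1 (hball x hx).2)
      (by positivity) (by positivity)
  · refine ae_of_all _ fun u x hx => ?_
    have hx0 : 0 < x := (half_pos hX).trans_le (hball x hx).1
    set s : ℂ := c + u * I with hs
    have hs0 : s ≠ 0 := fun h' => hc0 (by simpa [hs] using congrArg re h')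
    have hd : HasDerivAt (fun y : ℝ => (y : ℂ) ^ (-s)) (-s * (x : ℂ) ^ (-s - 1)) x := by
      have := (hasDerivAt_id (x : ℂ)).cpow_const (c := -s) (Or.inl (by simpa using hx0))
      simpa using this.comp_ofReal
    have := hd.const_mul (gammaKernel μ s)
    convert! this using 1
    have e : (((c + 1 : ℝ) : ℂ) + u * I) = s + 1 := by simp [hs]; ring
    rw [e, gammaKernel_succ μ hs0, show -(s + 1) = -s - 1 by ring]
    ring

/-- The kernel is invariant under s ↦ μ - s, which exchanges the two families of poles and inverts
X. -/
lemma barnesLine_symm (μ c : ℝ) {X : ℝ} (hX : 0 < X) :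
    barnesLine μ c X = ((X ^ (-μ) : ℝ) : ℂ) * barnesLine μ (μ - c) X⁻¹ := by
  rw [barnesLine, barnesLine, mul_left_comm]
  congr 1
  rw [← integral_const_mul, ← integral_neg_eq_self]
  congr 1
  ext u
  have e : (((μ - c : ℝ) : ℂ) + u * I) = μ - (c + ((-u : ℝ) : ℂ) * I) := by
    push_cast; ring
  rw [e, gammaKernel_symm, mul_left_comm]
  congr 1
  have hne : (X : ℂ) ≠ 0 := ofReal_ne_zero.2 hX.ne'
  rw [ofReal_inv, inv_cpow _ _ (by rw [arg_ofReal_of_nonneg hX.le]; exact Real.pi_pos.ne),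
    ← cpow_neg, ofReal_cpow hX.le, ← cpow_add _ _ hne]
  congr 1
  push_cast
  ring

lemma tendsto_barnesLine_zero (μ : ℝ) {c : ℝ} (hc : c < 0) :
    Tendsto (barnesLine μ c) (𝓝[>] 0) (𝓝 0) := by
  have hlim : Tendsto (fun X : ℝ => ‖(2 * Real.pi : ℂ)⁻¹‖ *
      ((∫ u : ℝ, ‖gammaKernel μ (c + u * I)‖) * X ^ (-c))) (𝓝[>] 0) (𝓝 0) := by
    have : Tendsto (fun X : ℝ => X ^ (-c)) (𝓝[>] 0) (𝓝 0) := by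
      have := (Real.continuousAt_rpow_const 0 (-c) (Or.inr (by linarith))).tendsto
      rw [Real.zero_rpow (by linarith)] at this
      exact this.mono_left nhdsWithin_le_nhds
    simpa using (this.const_mul (∫ u : ℝ, ‖gammaKernel μ (c + u * I)‖)).const_mul
      ‖(2 * Real.pi : ℂ)⁻¹‖
  refine squeeze_zero_norm' ?_ hlim
  filter_upwards [self_mem_nhdsWithin] with X hX
  rw [barnesLine, norm_mul, ← integral_mul_const]
  gcongr
  refine (norm_integral_le_integral_norm _).trans (le_of_eq ?_)
  congr 1
  ext u
  rw [norm_mul, norm_cpow_neg_line hX]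

/-! ### Evaluation of the Barnes integral on an arbitrary line -/

/-- The residue of `Γ(s) Γ(μ - s)` at `s = -k`. -/
def gammaResidue (μ : ℝ) (k : ℕ) : ℝ := (-1) ^ k / k.factorial * Real.Gamma (k + μ)

/-- `Γ(μ) (1 + X) ^ (-μ)` minus the contributions of the first `j` left and `l` right poles. -/
def barnesRemainder (μ : ℝ) (j l : ℕ) (X : ℝ) : ℝ :=
  Real.Gamma μ * (1 + X) ^ (-μ) - ∑ k ∈ Finset.range j, gammaResidue μ k * X ^ k -
    ∑ k ∈ Finset.range l, gammaResidue μ k * X ^ (-μ - k)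

/-- The left poles `-k` of `Γ(s) Γ(μ - s)` to the right of `Re s = c` are those with `k < j`, the
right poles `μ + k` to the left of it those with `k < l`. -/
structure WrongCount (μ c : ℝ) (j l : ℕ) : Prop where
  left : ∀ k : ℕ, k < j ↔ c < -k
  right : ∀ k : ℕ, k < l ↔ μ + k < c
  avoids : AvoidsPoles μ c

lemma WrongCount.symm {μ c : ℝ} {j l : ℕ} (h : WrongCount μ c j l) :
    WrongCount μ (μ - c) l j := by
  refine ⟨fun k => (h.right k).trans ?_, fun k => (h.left k).trans ?_, h.avoids.symm⟩ <;>
  constructor <;> intro <;> linarith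

lemma WrongCount.succ {μ c : ℝ} {j l : ℕ} (h : WrongCount μ c (j + 1) l) :
    WrongCount (μ + 1) (c + 1) j l := by
  refine ⟨fun k => ?_, fun k => (h.right k).trans ?_, h.avoids.succ⟩
  · have := h.left (k + 1)
    rw [Nat.add_lt_add_iff_right] at this
    rw [this]
    push_cast
    constructor <;> intro <;> linarith
  · constructor <;> intro <;> linarith

/-- This relation and the next one make the residue sums obey the same derivative recursion as the
line integral. -/
lemma gammaResidue_succ_mul (μ : ℝ) (k : ℕ) :
    gammaResidue μ (k + 1) * (k + 1) = -gammaResidue (μ + 1) k := by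
  have : (k.factorial : ℝ) ≠ 0 := by positivity
  rw [gammaResidue, gammaResidue, Nat.factorial_succ, pow_succ]
  push_cast
  rw [show (k : ℝ) + 1 + μ = k + (μ + 1) by ring]
  field_simp

lemma gammaResidue_mul {μ : ℝ} (k : ℕ) (h : (k : ℝ) + μ ≠ 0) :
    gammaResidue μ k * (-μ - k) = -gammaResidue (μ + 1) k := by
  rw [gammaResidue, gammaResidue, ← add_assoc, Real.Gamma_add_one h]
  ring

/-- The constant term of the left sum is lost on differentiation, which lowers j + 1 to j; every
right term survives because μ is not an integer. -/
lemma hasDerivAt_barnesRemainder {μ X : ℝ} (hμ : ∀ n : ℤ, μ ≠ n) (j l : ℕ) (hX : 0 < X) :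
    HasDerivAt (barnesRemainder μ (j + 1) l) (-barnesRemainder (μ + 1) j l X) X := by
  have h1 : HasDerivAt (fun X => Real.Gamma μ * (1 + X) ^ (-μ))
      (-(Real.Gamma (μ + 1) * (1 + X) ^ (-(μ + 1)))) X := by
    have := ((hasDerivAt_id X).const_add 1).rpow_const (p := -μ)
      (Or.inl (by simp; positivity)) |>.const_mul (Real.Gamma μ)
    convert! this using 1
    rw [Real.Gamma_add_one (by simpa using hμ 0), show -(μ + 1) = -μ - 1 by ring]
    simp
    ring
  have h2 : HasDerivAt (fun X : ℝ => ∑ k ∈ Finset.range (j + 1), gammaResidue μ k * X ^ k)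
      (-∑ k ∈ Finset.range j, gammaResidue (μ + 1) k * X ^ k) X := by
    have : HasDerivAt (fun X : ℝ => ∑ k ∈ Finset.range (j + 1), gammaResidue μ k * X ^ k)
        (∑ k ∈ Finset.range (j + 1), gammaResidue μ k * (k * X ^ (k - 1))) X :=
      HasDerivAt.fun_sum fun k _ => (hasDerivAt_pow k X).const_mul _
    convert! this using 1
    rw [Finset.sum_range_succ']
    simp only [Nat.cast_zero, zero_mul, mul_zero, add_zero, ← Finset.sum_neg_distrib]
    refine Finset.sum_congr rfl fun k _ => ?_
    rw [← neg_mul, ← gammaResidue_succ_mul]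
    push_cast
    ring
  have h3 : HasDerivAt (fun X : ℝ => ∑ k ∈ Finset.range l, gammaResidue μ k * X ^ (-μ - k))
      (-∑ k ∈ Finset.range l, gammaResidue (μ + 1) k * X ^ (-(μ + 1) - k)) X := by
    have : HasDerivAt (fun X : ℝ => ∑ k ∈ Finset.range l, gammaResidue μ k * X ^ (-μ - k))
        (∑ k ∈ Finset.range l, gammaResidue μ k * ((-μ - k) * X ^ (-μ - k - 1))) X :=
      HasDerivAt.fun_sum fun k _ => (Real.hasDerivAt_rpow_const (Or.inl hX.ne')).const_mul _
    convert! this using 1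
    simp only [← Finset.sum_neg_distrib]
    refine Finset.sum_congr rfl fun k _ => ?_
    have hk : (k : ℝ) + μ ≠ 0 := fun h0 => hμ (-k) (by push_cast; linarith)
    rw [← neg_mul, ← gammaResidue_mul k hk, show -(μ + 1) - (k : ℝ) = -μ - k - 1 by ring]
    ring
  convert! (h1.sub h2).sub h3 using 1
  rw [barnesRemainder]
  ring

/-- At X = 0 the term Γ(μ) cancels against the residue at s = 0, and the powers X^(-μ-k) have
positive exponents. -/
lemma tendsto_barnesRemainder_zero {μ : ℝ} (j l : ℕ) (hl : ∀ k < l, μ + k < 0) :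
    Tendsto (barnesRemainder μ (j + 1) l) (𝓝[>] 0) (𝓝 0) := by
  have hc : ContinuousAt (barnesRemainder μ (j + 1) l) 0 := by
    refine ContinuousAt.sub (ContinuousAt.sub ?_ (by fun_prop)) ?_
    · exact continuousAt_const.mul (ContinuousAt.rpow_const (by fun_prop) (Or.inl (by simp)))
    · refine tendsto_finsetSum _ fun k hk => ?_
      refine (continuousAt_const.mul (Real.continuousAt_rpow_const _ _ (Or.inr ?_))).tendsto
      have := hl k (Finset.mem_range.1 hk)
      linarith
  have h0 : barnesRemainder μ (j + 1) l 0 = 0 := by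
    rw [barnesRemainder, Finset.sum_range_succ', Finset.sum_eq_zero (s := Finset.range l)]
    · simp [gammaResidue]
    · intro k hk
      have := hl k (Finset.mem_range.1 hk)
      rw [Real.zero_rpow (by linarith), mul_zero]
  have := hc.tendsto
  rw [h0] at this
  exact this.mono_left nhdsWithin_le_nhds

lemma barnesRemainder_symm (μ : ℝ) (j l : ℕ) {X : ℝ} (hX : 0 < X) :
    barnesRemainder μ j l X = X ^ (-μ) * barnesRemainder μ l j X⁻¹ := by
  have h1 : X ^ (-μ) * (1 + X⁻¹) ^ (-μ) = (1 + X) ^ (-μ) := by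
    rw [← Real.mul_rpow hX.le (by positivity)]
    congr 1
    field_simp
    ring
  have h2 : ∀ k : ℕ, X ^ (-μ) * X⁻¹ ^ k = X ^ (-μ - k) := by
    intro k
    rw [Real.rpow_sub hX, Real.rpow_natCast, inv_pow]
    rfl
  have h3 : ∀ k : ℕ, X ^ (-μ) * X⁻¹ ^ (-μ - k) = X ^ k := by
    intro k
    rw [Real.inv_rpow hX.le, ← Real.rpow_neg hX.le, ← Real.rpow_add hX, ← Real.rpow_natCast]
    congr 1
    ring
  rw [barnesRemainder, barnesRemainder, mul_sub, mul_sub, Finset.mul_sum, Finset.mul_sum,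
    mul_left_comm, h1]
  simp only [mul_left_comm (X ^ (-μ)), h2, h3]
  ring

/-- Both sides have the same derivative on (0, ∞) and the same limit 0 at the origin. A misplaced
left pole forces c < 0, which is what makes the line integral vanish there. -/
lemma barnesLine_eq_of_wrongCount_succ {μ c : ℝ} {j l : ℕ} (h : WrongCount μ c (j + 1) l)
    (hμ : ∀ n : ℤ, μ ≠ n)
    (ih : ∀ X : ℝ, 0 < X → barnesLine (μ + 1) (c + 1) X = barnesRemainder (μ + 1) j l X)
    {X : ℝ} (hX : 0 < X) : barnesLine μ c X = barnesRemainder μ (j + 1) l X := by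
  set H : ℝ → ℂ := fun X => barnesLine μ c X - barnesRemainder μ (j + 1) l X with hH
  have hd : ∀ X : ℝ, 0 < X → HasDerivAt H 0 X := by
    intro X hX
    have := (hasDerivAt_barnesLine h.avoids hX).sub
      (hasDerivAt_barnesRemainder hμ j l hX).ofReal_comp
    convert! this using 1
    rw [ih X hX]
    simp
  have hc : c < 0 := by simpa using (h.left 0).1 (by lia)
  have ht : Tendsto H (𝓝[>] 0) (𝓝 0) := by
    have h1 := tendsto_barnesRemainder_zero (μ := μ) j l
      fun k hk => ((h.right k).1 hk).trans hc
    have h2 := (continuous_ofReal.tendsto (0 : ℝ)).comp h1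
    simpa using (tendsto_barnesLine_zero μ hc).sub h2
  have hconst : ∀ Y ∈ Ioi (0 : ℝ), H Y = H X := by
    intro Y hY
    exact isOpen_Ioi.is_const_of_deriv_eq_zero isPreconnected_Ioi
      (fun Z hZ => (hd Z hZ).differentiableAt.differentiableWithinAt)
      (fun Z hZ => (hd Z hZ).deriv) hY hX
  have : H X = 0 := by
    refine tendsto_nhds_unique (Tendsto.congr' ?_ tendsto_const_nhds) ht
    filter_upwards [self_mem_nhdsWithin] with Y hY
    exact (hconst Y hY).symm
  exact sub_eq_zero.1 this

lemma int_ne_add_one {μ : ℝ} (hμ : ∀ n : ℤ, μ ≠ n) : ∀ n : ℤ, μ + 1 ≠ n := by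
  intro n hn
  exact hμ (n - 1) (by push_cast; linarith)

lemma barnesLine_eq_of_left_zero (l : ℕ)
    (h0 : ∀ μ c X : ℝ, WrongCount μ c 0 l → (∀ n : ℤ, μ ≠ n) → 0 < X →
      barnesLine μ c X = barnesRemainder μ 0 l X) (j : ℕ) :
    ∀ μ c X : ℝ, WrongCount μ c j l → (∀ n : ℤ, μ ≠ n) → 0 < X →
      barnesLine μ c X = barnesRemainder μ j l X := by
  induction j with
  | zero => exact h0
  | succ j ih =>
    intro μ c X h hμ hX
    exact barnesLine_eq_of_wrongCount_succ h hμ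
      (fun Y hY => ih _ _ Y h.succ (int_ne_add_one hμ) hY) hX

lemma barnesLine_eq {μ c X : ℝ} {j l : ℕ} (h : WrongCount μ c j l) (hμ : ∀ n : ℤ, μ ≠ n)
    (hX : 0 < X) : barnesLine μ c X = barnesRemainder μ j l X := by
  have h00 : ∀ μ c X : ℝ, WrongCount μ c 0 0 → (∀ n : ℤ, μ ≠ n) → 0 < X →
      barnesLine μ c X = barnesRemainder μ 0 0 X := by
    intro μ c X h _ hX
    have h1 := h.left 0
    have h2 := h.right 0
    have h3 := h.avoids.1 0
    have h4 := h.avoids.2 0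
    simp at h1 h2 h3 h4
    rw [barnesLine_of_mem_strip (lt_of_le_of_ne h1 (Ne.symm h3)) (lt_of_le_of_ne h2 h4) hX]
    simp [barnesRemainder]
  -- Reflection reduces j = 0 with l right poles to l left poles and no right pole, which the
  -- induction on left poles already settles.
  refine barnesLine_eq_of_left_zero l (fun μ c X h hμ hX => ?_) j μ c X h hμ hX
  rw [barnesLine_symm μ c hX, barnesRemainder_symm μ 0 l hX,
    barnesLine_eq_of_left_zero 0 h00 l μ (μ - c) X⁻¹ h.symm hμ (inv_pos.2 hX)]
  push_cast
  rfl

/-! ### A Parseval formula for Mellin transforms -/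

lemma cpow_neg_mul_cpow_add {y w : ℝ} (hy : 0 < y) (hw : 0 < w) (s z : ℂ) :
    (y : ℂ) ^ (-z) * (w : ℂ) ^ (s + z - 1) = (w : ℂ) ^ (s - 1) * ((y / w : ℝ) : ℂ) ^ (-z) := by
  have hne : (w : ℂ) ≠ 0 := ofReal_ne_zero.2 hw.ne'
  rw [div_eq_mul_inv, ofReal_mul, mul_cpow_ofReal_nonneg hy.le (by positivity), ofReal_inv,
    inv_cpow _ _ (by rw [arg_ofReal_of_nonneg hw.le]; exact Real.pi_pos.ne), ← cpow_neg, neg_neg,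
    mul_left_comm, ← cpow_add _ _ hne]
  congr 2
  ring

/-- Fubini for φ(u) y^(-(d+iu)) w^(s+d+iu-1) k(w): the imaginary powers have modulus one, so
absolute convergence follows from that of φ and of the Mellin integral at s + d separately. -/
lemma mellin_parseval {k : ℝ → ℂ} {φ : ℝ → ℂ} {s : ℂ} {d y : ℝ} (hk : MellinConvergent k (s + d))
    (hφ : Integrable φ) (hy : 0 < y) :
    Integrable (fun u : ℝ => mellin k (s + (d + u * I)) * φ u * (y : ℂ) ^ (-(d + u * I : ℂ))) ∧
    MellinConvergent (fun w => k w * ∫ u : ℝ, φ u * ((y / w : ℝ) : ℂ) ^ (-(d + u * I : ℂ))) s ∧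
    ∫ u : ℝ, mellin k (s + (d + u * I)) * φ u * (y : ℂ) ^ (-(d + u * I : ℂ)) =
      mellin (fun w => k w * ∫ u : ℝ, φ u * ((y / w : ℝ) : ℂ) ^ (-(d + u * I : ℂ))) s := by
  set G : ℝ → ℝ → ℂ := fun u w =>
    φ u * (y : ℂ) ^ (-(d + u * I : ℂ)) * ((w : ℂ) ^ (s + (d + u * I) - 1) * k w) with hG
  have hprod : Integrable (fun p : ℝ × ℝ => φ p.1 * ((p.2 : ℂ) ^ (s + d - 1) • k p.2))
      (volume.prod (volume.restrict (Ioi 0))) := hφ.mul_prod hk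
  have hG_int : Integrable (Function.uncurry G) (volume.prod (volume.restrict (Ioi 0))) := by
    have hb := hprod.mul_bdd (c := y ^ (-d))
      (g := fun p : ℝ × ℝ => (y : ℂ) ^ (-(d + p.1 * I : ℂ)) * (p.2 : ℂ) ^ (p.1 * I : ℂ)) ?_ ?_
    · refine hb.congr ?_
      have : ∀ᵐ p : ℝ × ℝ ∂(volume.prod (volume.restrict (Ioi 0))), 0 < p.2 :=
        Measure.quasiMeasurePreserving_snd.ae (ae_restrict_mem measurableSet_Ioi)
      filter_upwards [this] with p hp
      have hne : (p.2 : ℂ) ≠ 0 := ofReal_ne_zero.2 hp.ne'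
      simp only [Function.uncurry, hG, smul_eq_mul]
      rw [show s + (d + p.1 * I) - 1 = (s + d - 1) + p.1 * I by ring, cpow_add _ _ hne]
      ring
    · refine Measurable.aestronglyMeasurable ?_
      fun_prop
    · have : ∀ᵐ p : ℝ × ℝ ∂(volume.prod (volume.restrict (Ioi 0))), 0 < p.2 :=
        Measure.quasiMeasurePreserving_snd.ae (ae_restrict_mem measurableSet_Ioi)
      filter_upwards [this] with p hp
      rw [norm_mul, norm_cpow_neg_line hy, norm_cpow_eq_rpow_re_of_pos hp]
      simp
  have e1 : ∀ u : ℝ, ∫ w in Ioi 0, G u w =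
      mellin k (s + (d + u * I)) * φ u * (y : ℂ) ^ (-(d + u * I : ℂ)) := by
    intro u
    simp only [hG, integral_const_mul, mellin, smul_eq_mul]
    ring
  have e2 : ∀ w ∈ Ioi (0 : ℝ), ∫ u, G u w =
      (w : ℂ) ^ (s - 1) • (k w * ∫ u : ℝ, φ u * ((y / w : ℝ) : ℂ) ^ (-(d + u * I : ℂ))) := by
    intro w hw
    rw [smul_eq_mul, ← integral_const_mul, ← integral_const_mul]
    congr 1
    ext u
    have := cpow_neg_mul_cpow_add hy hw s (d + u * I)
    simp only [hG]
    linear_combination φ u * k w * this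
  refine ⟨?_, ?_, ?_⟩
  · have := hG_int.integral_prod_left
    simpa only [Function.uncurry, e1] using this
  · exact (integrable_congr ((ae_restrict_mem measurableSet_Ioi).mono fun w hw => e2 w hw)).1
      hG_int.integral_prod_right
  · have := integral_integral_swap hG_int
    simp only [e1] at this
    rw [this, mellin]
    exact setIntegral_congr_fun measurableSet_Ioi e2

/-! ### The inner integral -/

/-- The inverse Mellin transform, in `s`, of the inner integral of the G-function. -/
def innerDensity (ν : ℝ) (a : ℕ) (y w : ℝ) : ℝ :=
  w ^ (ν - a) * (Real.Gamma ν * (1 + w) ^ (-ν)) *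
    (Real.Gamma (1 + a) * (1 + y / w) ^ (-(1 + a : ℝ)))

lemma continuousOn_innerDensity (ν : ℝ) (a : ℕ) {y : ℝ} (hy : 0 < y) :
    ContinuousOn (fun w => (innerDensity ν a y w : ℂ)) (Ioi 0) := by
  refine continuous_ofReal.comp_continuousOn ?_
  refine ContinuousOn.mul (ContinuousOn.mul ?_ (continuousOn_const.mul ?_))
    (continuousOn_const.mul ?_)
  · exact continuousOn_id.rpow_const fun w hw => Or.inl (ne_of_gt hw)
  · refine ContinuousOn.rpow_const (by fun_prop) fun w hw => Or.inl ?_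
    have : (0 : ℝ) < w := hw
    positivity
  · refine ContinuousOn.rpow_const ?_ fun w hw => Or.inl ?_
    · refine continuousOn_const.add (continuousOn_const.div continuousOn_id fun w hw => ne_of_gt hw)
    · have : (0 : ℝ) < w := hw
      positivity

lemma innerDensity_isBigO_atTop {ν : ℝ} (hν : 0 < ν) (a : ℕ) {y : ℝ} (hy : 0 < y) :
    (fun w => (innerDensity ν a y w : ℂ)) =O[atTop] (· ^ (-(a : ℝ))) := by
  have hG := Real.Gamma_pos_of_pos hν
  have hG' : 0 < Real.Gamma (1 + a) := Real.Gamma_pos_of_pos (by positivity)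
  refine Asymptotics.IsBigO.of_bound (Real.Gamma ν * Real.Gamma (1 + a)) ?_
  filter_upwards [eventually_gt_atTop 0] with w hw
  have h1 : (1 + w) ^ (-ν) ≤ w ^ (-ν) :=
    Real.rpow_le_rpow_of_nonpos hw (by linarith) (by linarith)
  have h2 : (1 + y / w) ^ (-(1 + a : ℝ)) ≤ 1 :=
    Real.rpow_le_one_of_one_le_of_nonpos (by linarith [div_pos hy hw])
      (by linarith [a.cast_nonneg (α := ℝ)])
  have h3 : w ^ (-(a : ℝ)) = w ^ (ν - a) * w ^ (-ν) := by
    rw [← Real.rpow_add hw]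
    congr 1
    ring
  rw [Complex.norm_real, Real.norm_of_nonneg (by rw [innerDensity]; positivity),
    Real.norm_of_nonneg (by positivity), innerDensity, h3]
  calc _ ≤ w ^ (ν - a) * (Real.Gamma ν * w ^ (-ν)) * (Real.Gamma (1 + a) * 1) := by gcongr
    _ = _ := by ring

lemma innerDensity_isBigO_zero {ν : ℝ} (hν : 0 < ν) (a : ℕ) {y : ℝ} (hy : 0 < y) :
    (fun w => (innerDensity ν a y w : ℂ)) =O[𝓝[>] 0] (· ^ (-(-ν - 1))) := by
  have hG := Real.Gamma_pos_of_pos hν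
  have hG' : 0 < Real.Gamma (1 + a) := Real.Gamma_pos_of_pos (by positivity)
  refine Asymptotics.IsBigO.of_bound
    (Real.Gamma ν * Real.Gamma (1 + a) * y ^ (-(1 + a : ℝ))) ?_
  filter_upwards [self_mem_nhdsWithin] with w hw
  have hw : 0 < w := hw
  have h1 : (1 + w) ^ (-ν) ≤ 1 :=
    Real.rpow_le_one_of_one_le_of_nonpos (by linarith) (by linarith)
  have h2 : (1 + y / w) ^ (-(1 + a : ℝ)) ≤ (y / w) ^ (-(1 + a : ℝ)) :=
    Real.rpow_le_rpow_of_nonpos (by positivity) (by linarith)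
      (by linarith [a.cast_nonneg (α := ℝ)])
  have h3 : w ^ (-(-ν - 1)) * y ^ (-(1 + a : ℝ)) = w ^ (ν - a) * (y / w) ^ (-(1 + a : ℝ)) := by
    rw [Real.div_rpow hy.le hw.le, Real.rpow_neg hw.le (1 + a), div_inv_eq_mul, mul_left_comm,
      ← Real.rpow_add hw, mul_comm]
    congr 2
    ring
  rw [Complex.norm_real, Real.norm_of_nonneg (by rw [innerDensity]; positivity),
    Real.norm_of_nonneg (by positivity), innerDensity]
  calc _ ≤ w ^ (ν - a) * (Real.Gamma ν * 1) *
        (Real.Gamma (1 + a) * (y / w) ^ (-(1 + a : ℝ))) := by gcongr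
    _ = _ := by linear_combination (-Real.Gamma ν * Real.Gamma (1 + a)) * h3

/-- The density is O(w^(-a)) at infinity and O(w^(ν+1)) at 0. The resulting strip is exactly the set
of Re s for which some admissible line exists in the t-plane. -/
lemma mellinConvergent_innerDensity {ν : ℝ} (hν : 0 < ν) (a : ℕ) {y : ℝ} (hy : 0 < y) {s : ℂ}
    (h0 : -ν - 1 < s.re) (h1 : s.re < a) :
    MellinConvergent (fun w => (innerDensity ν a y w : ℂ)) s :=
  mellinConvergent_of_isBigO_rpow
    ((continuousOn_innerDensity ν a hy).locallyIntegrableOn measurableSet_Ioi)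
    (innerDensity_isBigO_atTop hν a hy) h1 (innerDensity_isBigO_zero hν a hy) h0

lemma differentiableAt_mellin_innerDensity {ν : ℝ} (hν : 0 < ν) (a : ℕ) {y : ℝ} (hy : 0 < y)
    {s : ℂ} (h0 : -ν - 1 < s.re) (h1 : s.re < a) :
    DifferentiableAt ℂ (mellin fun w => (innerDensity ν a y w : ℂ)) s :=
  mellin_differentiableAt_of_isBigO_rpow
    ((continuousOn_innerDensity ν a hy).locallyIntegrableOn measurableSet_Ioi)
    (innerDensity_isBigO_atTop hν a hy) h1 (innerDensity_isBigO_zero hν a hy) h0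

lemma block11_kernel (a b : ℝ) (s : ℂ) :
    (block11 a b).kernel s = gammaKernel (1 - a + b) (b + s) := by
  simp only [MeijerBlock.kernel, block11, List.map_cons, List.map_nil, List.prod_cons,
    List.prod_nil, mul_one, div_one, gammaKernel]
  congr 2
  push_cast
  ring

lemma block11_leftPoles (a b : ℝ) : (block11 a b).leftPoles = {p : ℂ | ∃ k : ℕ, p = -b - k} := by
  simp [MeijerBlock.leftPoles, block11]

lemma block11_rightPoles (a b : ℝ) : (block11 a b).rightPoles = {p : ℂ | ∃ k : ℕ, p = 1 - a + k} := by
  simp [MeijerBlock.rightPoles, block11]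

/-- Parseval with φ(u) = Γ(t) Γ(1 + a - t) at t = d + iu, whose Barnes integral is known in its
strip. The right-hand side is free of d, so the arbitrary choice of d(s) along the contour does not
spoil holomorphy in s. -/
lemma inner_integral {ν : ℝ} (a : ℕ) {y d : ℝ} (hy : 0 < y) {s : ℂ}
    (hd0 : 0 < d) (hd1 : d < 1 + a) (h0 : a - ν < s.re + d) (h1 : s.re + d < a) :
    Integrable (fun u : ℝ => (block11 (1 - a) (ν - a)).kernel (s + (d + u * I)) *
      (block11 (-a) 0).kernel (d + u * I) * (y : ℂ) ^ (-(d + u * I : ℂ))) ∧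
    (2 * Real.pi : ℂ)⁻¹ * ∫ u : ℝ, (block11 (1 - a) (ν - a)).kernel (s + (d + u * I)) *
      (block11 (-a) 0).kernel (d + u * I) * (y : ℂ) ^ (-(d + u * I : ℂ)) =
    mellin (fun w => (innerDensity ν a y w : ℂ)) s := by
  -- The power w^(ν-a) shifts the Mellin variable, so that the transform of f is the first block.
  set f : ℝ → ℂ := fun w =>
    (w : ℂ) ^ ((ν - a : ℝ) : ℂ) • ((Real.Gamma ν * (1 + w) ^ (-ν) : ℝ) : ℂ) with hf
  have hm : ∀ u : ℝ, (block11 (1 - a) (ν - a)).kernel (s + (d + u * I)) =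
      mellin f (s + (d + u * I)) := by
    intro u
    rw [block11_kernel, hf, mellin_cpow_smul, mellin_Gamma_mul_one_add_rpow]
    · congr 1
      · ring
      · ring
    · simp; linarith
    · simp; linarith
  have h3 : ∀ u : ℝ, (block11 (-a) 0).kernel (d + u * I) = gammaKernel (1 + a) (d + u * I) := by
    intro u
    rw [block11_kernel]
    simp
  have hcv : MellinConvergent f (s + d) := by
    rw [hf, MellinConvergent.cpow_smul]
    have := (mellinConvergent_one_add_rpow (μ := ν) (s := s + d + (ν - a : ℝ)) (by simp; linarith)
      (by simp; linarith)).const_smul (Real.Gamma ν : ℂ)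
    simpa only [smul_eq_mul, ← ofReal_mul] using this
  have hG_int := integrable_gammaKernel_line (avoidsPoles_of_mem_strip hd0 hd1)
  obtain ⟨p1, -, p3⟩ := mellin_parseval hcv hG_int hy
  simp only [hm, h3]
  refine ⟨p1, ?_⟩
  rw [p3, ← smul_eq_mul, ← mellin_const_smul]
  refine setIntegral_congr_fun measurableSet_Ioi fun w hw => ?_
  have hw : 0 < w := hw
  have hb := barnesLine_of_mem_strip hd0 hd1 (div_pos hy hw)
  rw [barnesLine] at hb
  simp only [smul_eq_mul]
  rw [mul_left_comm _ (f w), hb]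
  simp only [innerDensity, hf, smul_eq_mul]
  rw [ofReal_mul (w ^ (ν - a) * _), ofReal_mul (w ^ (ν - a)), ofReal_cpow hw.le]

/-! ### Residues -/

/-- `(s + k) Γ(s)`, with the singularity at `s = -k` removed. -/
def gammaRegular (k : ℕ) (s : ℂ) : ℂ :=
  Gamma (s + k + 1) / ∏ i ∈ Finset.range k, (s + i)

lemma Gamma_add_natCast {s : ℂ} (n : ℕ) (h : ∀ i < n, s + i ≠ 0) :
    Gamma (s + n) = (∏ i ∈ Finset.range n, (s + i)) * Gamma s := by
  induction n with
  | zero => simp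
  | succ n ih =>
    rw [Finset.prod_range_succ, Nat.cast_succ, ← add_assoc, Gamma_add_one _ (h n (by lia)),
      ih fun i hi => h i (by lia)]
    ring

lemma Gamma_eq_inv_mul_gammaRegular {s : ℂ} (k : ℕ) (h : ∀ i : ℕ, s ≠ -i) :
    Gamma s = (s + k)⁻¹ * gammaRegular k s := by
  have h' : ∀ i : ℕ, s + i ≠ 0 := fun i hi => h i (eq_neg_of_add_eq_zero_left hi)
  have hp : ∏ i ∈ Finset.range k, (s + i) ≠ 0 := Finset.prod_ne_zero_iff.2 fun i _ => h' i
  rw [gammaRegular, Gamma_add_one _ (h' k), Gamma_add_natCast k fun i _ => h' i]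
  have := h' k
  field_simp

lemma gammaRegular_neg (k : ℕ) : gammaRegular k (-k) = (-1) ^ k / k.factorial := by
  have : ∏ i ∈ Finset.range k, (-(k : ℂ) + i) = (-1) ^ k * k.factorial := by
    rw [← Finset.prod_range_reflect, ← Finset.prod_range_add_one_eq_factorial]
    push_cast
    rw [show ((-1 : ℂ)) ^ k = ∏ _i ∈ Finset.range k, (-1 : ℂ) by simp, ← Finset.prod_mul_distrib]
    refine Finset.prod_congr rfl fun i hi => ?_
    have hi : i < k := Finset.mem_range.1 hi
    rw [show k - 1 - i = k - (i + 1) by lia, Nat.cast_sub (by lia)]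
    push_cast
    ring
  rw [gammaRegular, this]
  have h1 : ((-1 : ℂ) ^ k) * (-1) ^ k = 1 := by rw [← mul_pow]; simp
  have h2 : (k.factorial : ℂ) ≠ 0 := by exact_mod_cast k.factorial_ne_zero
  have h3 : ((-1 : ℂ) ^ k) ≠ 0 := by simp
  simp only [neg_add_cancel, zero_add, Gamma_one]
  field_simp
  rw [sq, h1]

lemma differentiableAt_gammaRegular {k : ℕ} {s : ℂ} (h : ∀ i : ℕ, i ≠ k → s ≠ -i) :
    DifferentiableAt ℂ (gammaRegular k) s := by
  refine DifferentiableAt.div ?_ (by fun_prop) ?_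
  · refine DifferentiableAt.comp (g := Gamma) s ?_ (by fun_prop)
    refine differentiableAt_Gamma _ fun m hm => h (m + k + 1) (by lia) ?_
    push_cast
    linear_combination hm
  · refine Finset.prod_ne_zero_iff.2 fun i hi h0 => h i ?_ (eq_neg_of_add_eq_zero_left h0)
    have := Finset.mem_range.1 hi
    lia

/-- Cauchy's integral formula, after splitting Γ(z) into (z + k)⁻¹ and a factor holomorphic on the
disc. -/
lemma circleIntegral_gammaKernel_left {μ r : ℝ} {h : ℂ → ℂ} (hr : 0 < r) (k : ℕ)
    (hh : DifferentiableOn ℂ h (Metric.closedBall (-k : ℂ) r))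
    (hl : ∀ i : ℕ, i ≠ k → (-i : ℂ) ∉ Metric.closedBall (-k : ℂ) r)
    (hrt : ∀ i : ℕ, (μ + i : ℂ) ∉ Metric.closedBall (-k : ℂ) r) :
    (∮ z in C(-k, r), gammaKernel μ z * h z) =
      2 * Real.pi * I * (gammaResidue μ k * h (-k)) := by
  have hd : DifferentiableOn ℂ (fun z => gammaRegular k z * Gamma (μ - z) * h z)
      (Metric.closedBall (-k : ℂ) r) := by
    refine DifferentiableOn.mul (fun z hz => DifferentiableAt.differentiableWithinAt ?_) hh
    refine DifferentiableAt.mul (differentiableAt_gammaRegular fun i hi h0 => hl i hi (h0 ▸ hz)) ?_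
    refine DifferentiableAt.comp (g := Gamma) z ?_ (by fun_prop)
    refine differentiableAt_Gamma _ fun m hm => hrt m ?_
    convert! hz using 1
    linear_combination hm
  have := hd.circleIntegral_sub_inv_smul (Metric.mem_ball_self hr)
  rw [gammaRegular_neg] at this
  simp only [smul_eq_mul] at this
  rw [show ((gammaResidue μ k : ℝ) : ℂ) = (-1) ^ k / k.factorial * Gamma (μ - (-k)) by
    rw [gammaResidue]; push_cast; rw [← Gamma_ofReal]; push_cast; congr 2; ring, ← this]
  refine circleIntegral.integral_congr hr.le fun z hz => ?_
  have hz' : z ∈ Metric.closedBall (-k : ℂ) r := Metric.sphere_subset_closedBall hz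
  have : ∀ i : ℕ, z ≠ -i := by
    intro i hi
    rcases eq_or_ne i k with rfl | hik
    · rw [hi, Metric.mem_sphere, dist_self] at hz
      exact hr.ne hz
    · exact hl i hik (hi ▸ hz')
  simp only [gammaKernel]
  rw [Gamma_eq_inv_mul_gammaRegular k this, sub_neg_eq_add]
  ring

/-- Here the simple pole comes from Γ(μ - z), whose argument runs backwards; this is the source of
the minus sign. -/
lemma circleIntegral_gammaKernel_right {μ r : ℝ} {h : ℂ → ℂ} (hr : 0 < r) (k : ℕ)
    (hh : DifferentiableOn ℂ h (Metric.closedBall (μ + k : ℂ) r))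
    (hl : ∀ i : ℕ, (-i : ℂ) ∉ Metric.closedBall (μ + k : ℂ) r)
    (hrt : ∀ i : ℕ, i ≠ k → (μ + i : ℂ) ∉ Metric.closedBall (μ + k : ℂ) r) :
    (∮ z in C(μ + k, r), gammaKernel μ z * h z) =
      -(2 * Real.pi * I * (gammaResidue μ k * h (μ + k))) := by
  have hd : DifferentiableOn ℂ (fun z => -(Gamma z * gammaRegular k (μ - z) * h z))
      (Metric.closedBall (μ + k : ℂ) r) := by
    refine (DifferentiableOn.mul (fun z hz => DifferentiableAt.differentiableWithinAt ?_) hh).neg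
    refine DifferentiableAt.mul (differentiableAt_Gamma _ fun m hm => hl m (hm ▸ hz)) ?_
    refine DifferentiableAt.comp (g := gammaRegular k) z ?_ (by fun_prop)
    refine differentiableAt_gammaRegular fun i hi h0 => hrt i hi ?_
    convert! hz using 1
    linear_combination h0
  have := hd.circleIntegral_sub_inv_smul (Metric.mem_ball_self hr)
  rw [show (μ : ℂ) - (μ + k) = -k by ring, gammaRegular_neg] at this
  simp only [smul_eq_mul] at this
  rw [show -(2 * Real.pi * I * (gammaResidue μ k * h (μ + k))) = 2 * Real.pi * I *
      -(Gamma (μ + k) * ((-1) ^ k / k.factorial) * h (μ + k)) by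
    rw [gammaResidue]; push_cast; rw [← Gamma_ofReal]; push_cast; rw [add_comm (k : ℂ)]; ring,
    ← this]
  refine circleIntegral.integral_congr hr.le fun z hz => ?_
  have hz' : z ∈ Metric.closedBall (μ + k : ℂ) r := Metric.sphere_subset_closedBall hz
  have : ∀ i : ℕ, (μ : ℂ) - z ≠ -i := by
    intro i hi
    have hi : z = μ + i := by linear_combination -hi
    rcases eq_or_ne i k with rfl | hik
    · rw [hi, Metric.mem_sphere, dist_self] at hz
      exact hr.ne hz
    · exact hrt i hik (hi ▸ hz')
  simp only [gammaKernel]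
  rw [Gamma_eq_inv_mul_gammaRegular k this,
    show (μ : ℂ) - z + k = -(z - (μ + k)) by ring, inv_neg]
  ring

lemma differentiableAt_gammaKernel {μ : ℝ} {s : ℂ} (hl : ∀ i : ℕ, s ≠ -i)
    (hr : ∀ i : ℕ, s ≠ μ + i) : DifferentiableAt ℂ (gammaKernel μ) s := by
  refine DifferentiableAt.mul (differentiableAt_Gamma _ hl) ?_
  refine DifferentiableAt.comp (g := Gamma) s ?_ (by fun_prop)
  refine differentiableAt_Gamma _ fun m hm => hr m ?_
  linear_combination -hm

/-! ### Value of the G-function along admissible contours -/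

/-- The closed form of the G-function as a real integral. -/
def gFunctionValue (ν : ℝ) (a : ℕ) (x y : ℝ) : ℝ :=
  Real.Gamma ν * Real.Gamma (-ν) * a.factorial *
    ∫ w in Ioi (0 : ℝ), ((w + x) / (w + 1)) ^ ν * ((w + y) ^ (a + 1))⁻¹

lemma wrongCount_ceil {μ c : ℝ} (h : AvoidsPoles μ c) :
    WrongCount μ c ⌈-c⌉₊ ⌈c - μ⌉₊ := by
  refine ⟨fun k => ?_, fun k => ?_, h⟩ <;> rw [Nat.lt_ceil] <;> constructor <;> intro <;> linarith

lemma mem_leftPoles_block {ν : ℝ} {p : ℂ} :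
    p ∈ (block11 (1 + ν) 0).leftPoles ↔ ∃ k : ℕ, p = -k := by
  simp [block11_leftPoles]

lemma mem_rightPoles_block {ν : ℝ} {p : ℂ} :
    p ∈ (block11 (1 + ν) 0).rightPoles ↔ ∃ k : ℕ, p = ((-ν : ℝ) : ℂ) + k := by
  simp [block11_rightPoles]

section Contour

variable {ν : ℝ} {a : ℕ} {x y : ℝ} {C : BarnesContour}

/-- Only the first pole of each of the four progressions matters for the t-line. -/
lemma BarnesContour.Admissible.mem_strip
    (hC : C.Admissible (block11 (1 - a) (ν - a)) (block11 (1 + ν) 0) (block11 (-a) 0))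
    {s : ℂ} (hs : s ∈ C.support (block11 (1 + ν) 0)) :
    0 < C.d s ∧ C.d s < 1 + a ∧ a - ν < s.re + C.d s ∧ s.re + C.d s < a := by
  have h1 := hC.left_t s hs 0 (by rw [block11_leftPoles]; exact ⟨0, by simp⟩)
  have h2 := hC.right_t s hs (1 + a) (by rw [block11_rightPoles]; exact ⟨0, by simp⟩)
  have h3 := hC.left_st s hs (a - ν) (by rw [block11_leftPoles]; exact ⟨0, by simp⟩)
  have h4 := hC.right_st s hs a (by rw [block11_rightPoles]; exact ⟨0, by simp⟩)
  simp at h1 h2 h3 h4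
  exact ⟨h1, h2, h3, h4⟩

lemma BarnesContour.Admissible.outerIntegrand_eq (hy : 0 < y)
    (hC : C.Admissible (block11 (1 - a) (ν - a)) (block11 (1 + ν) 0) (block11 (-a) 0))
    {s : ℂ} (hs : s ∈ C.support (block11 (1 + ν) 0)) :
    C.outerIntegrand (block11 (1 - a) (ν - a)) (block11 (1 + ν) 0) (block11 (-a) 0) x y s =
      gammaKernel (-ν) s * ((x : ℂ) ^ (-s) * mellin (fun w => (innerDensity ν a y w : ℂ)) s) := by
  obtain ⟨h1, h2, h3, h4⟩ := hC.mem_strip hs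
  rw [BarnesContour.outerIntegrand, ← (inner_integral a hy h1 h2 h3 h4).2, block11_kernel]
  simp [BarnesContour.innerIntegrand, mul_assoc]

/-- The closed discs bounded by the circles of the contour stay in the strip of convergence. -/
lemma BarnesContour.Admissible.closedBall_strip
    (hC : C.Admissible (block11 (1 - a) (ν - a)) (block11 (1 + ν) 0) (block11 (-a) 0))
    {p : ℂ} (hp : p ∈ C.wrongLeft (block11 (1 + ν) 0) ∪ C.wrongRight (block11 (1 + ν) 0))
    {z : ℂ} (hz : z ∈ Metric.closedBall p C.r) : -ν - 1 < z.re ∧ z.re < a := by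
  have hr := hC.r_pos
  -- The points p ± r lie on the contour and have the extreme real parts of the disc, so the strip
  -- conditions at these two points control the whole disc.
  have e1 := hC.mem_strip (s := p + C.r) (Or.inr ⟨p, hp, by simp [abs_of_pos hr]⟩)
  have e2 := hC.mem_strip (s := p - C.r) (Or.inr ⟨p, hp, by simp [abs_of_pos hr]⟩)
  have e3 : |(z - p).re| ≤ C.r := (abs_re_le_norm _).trans (by simpa [dist_eq] using hz)
  simp only [add_re, sub_re, ofReal_re] at e1 e2 e3
  rw [abs_le] at e3
  constructor <;> linarith

lemma BarnesContour.Admissible.avoidsPoles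
    (hC : C.Admissible (block11 (1 - a) (ν - a)) (block11 (1 + ν) 0) (block11 (-a) 0)) :
    AvoidsPoles (-ν) C.c := by
  refine ⟨fun k hk => ?_, fun k hk => ?_⟩
  · exact hC.line (-k) (Or.inl (mem_leftPoles_block.2 ⟨k, rfl⟩)) (by simp [hk])
  · exact hC.line ((-ν : ℝ) + k) (Or.inr (mem_rightPoles_block.2 ⟨k, rfl⟩)) (by simp [hk])

lemma differentiableOn_cpow_mul_mellin (hν : 0 < ν) (hx : 0 < x) (hy : 0 < y)
    (hC : C.Admissible (block11 (1 - a) (ν - a)) (block11 (1 + ν) 0) (block11 (-a) 0))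
    {p : ℂ} (hp : p ∈ C.wrongLeft (block11 (1 + ν) 0) ∪ C.wrongRight (block11 (1 + ν) 0)) :
    DifferentiableOn ℂ (fun s => (x : ℂ) ^ (-s) * mellin (fun w => (innerDensity ν a y w : ℂ)) s)
      (Metric.closedBall p C.r) := by
  intro z hz
  obtain ⟨h0, h1⟩ := hC.closedBall_strip hp hz
  refine DifferentiableAt.differentiableWithinAt (DifferentiableAt.mul ?_
    (differentiableAt_mellin_innerDensity hν a hy h0 h1))
  exact DifferentiableAt.const_cpow (by fun_prop) (Or.inl (ofReal_ne_zero.2 hx.ne'))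

lemma BarnesContour.Admissible.eq_center
    (hC : C.Admissible (block11 (1 - a) (ν - a)) (block11 (1 + ν) 0) (block11 (-a) 0))
    {p : ℂ} (hp : p ∈ C.wrongLeft (block11 (1 + ν) 0) ∪ C.wrongRight (block11 (1 + ν) 0))
    {q : ℂ} (hq : q ∈ (block11 (1 + ν) 0).leftPoles ∪ (block11 (1 + ν) 0).rightPoles)
    (hqp : q ∈ Metric.closedBall p C.r) : q = p := by
  by_contra h
  exact absurd (hC.circle_pole p hp q hq h) (not_lt.2 hqp)

lemma BarnesContour.Admissible.circleIntegrable (hν : 0 < ν) (hx : 0 < x) (hy : 0 < y)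
    (hC : C.Admissible (block11 (1 - a) (ν - a)) (block11 (1 + ν) 0) (block11 (-a) 0))
    {p : ℂ} (hp : p ∈ C.wrongLeft (block11 (1 + ν) 0) ∪ C.wrongRight (block11 (1 + ν) 0)) :
    CircleIntegrable
      (C.outerIntegrand (block11 (1 - a) (ν - a)) (block11 (1 + ν) 0) (block11 (-a) 0) x y)
      p C.r := by
  refine ContinuousOn.circleIntegrable hC.r_pos.le ?_
  have hne : ∀ z ∈ Metric.sphere p C.r,
      ∀ q ∈ (block11 (1 + ν) 0).leftPoles ∪ (block11 (1 + ν) 0).rightPoles, z ≠ q := by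
    rintro z hz q hq rfl
    rw [hC.eq_center hp hq (Metric.sphere_subset_closedBall hz), Metric.mem_sphere, dist_self] at hz
    exact hC.r_pos.ne hz
  refine ContinuousOn.congr (f := fun s => gammaKernel (-ν) s *
    ((x : ℂ) ^ (-s) * mellin (fun w => (innerDensity ν a y w : ℂ)) s)) ?_
    fun z hz => hC.outerIntegrand_eq hy (Or.inr ⟨p, hp, hz⟩)
  refine ContinuousOn.mul (fun z hz => ContinuousAt.continuousWithinAt ?_)
    ((differentiableOn_cpow_mul_mellin hν hx hy hC hp).continuousOn.mono
      Metric.sphere_subset_closedBall)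
  exact (differentiableAt_gammaKernel
    (fun i => hne z hz _ (Or.inl (mem_leftPoles_block.2 ⟨i, rfl⟩)))
    (fun i => hne z hz _ (Or.inr (mem_rightPoles_block.2 ⟨i, rfl⟩)))).continuousAt

lemma BarnesContour.Admissible.left_ne_right
    (hC : C.Admissible (block11 (1 - a) (ν - a)) (block11 (1 + ν) 0) (block11 (-a) 0)) (i k : ℕ) :
    (-i : ℂ) ≠ (-ν : ℝ) + k := by
  intro h
  exact Set.disjoint_left.1 hC.disjoint (mem_leftPoles_block.2 ⟨i, rfl⟩)
    (mem_rightPoles_block.2 ⟨k, h⟩)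

lemma BarnesContour.Admissible.loop_left (hν : 0 < ν) (hx : 0 < x) (hy : 0 < y)
    (hC : C.Admissible (block11 (1 - a) (ν - a)) (block11 (1 + ν) 0) (block11 (-a) 0))
    {k : ℕ} (hp : (-k : ℂ) ∈ C.wrongLeft (block11 (1 + ν) 0)) :
    C.loop (block11 (1 - a) (ν - a)) (block11 (1 + ν) 0) (block11 (-a) 0) x y (-k) =
      gammaResidue (-ν) k * ((x : ℂ) ^ (-(-k : ℂ)) *
        mellin (fun w => (innerDensity ν a y w : ℂ)) (-k)) := by
  have hp' := mem_union_left (C.wrongRight (block11 (1 + ν) 0)) hp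
  rw [BarnesContour.loop, circleIntegral.integral_congr hC.r_pos.le
    (fun z hz => hC.outerIntegrand_eq hy (Or.inr ⟨_, hp', hz⟩)),
    circleIntegral_gammaKernel_left hC.r_pos k (differentiableOn_cpow_mul_mellin hν hx hy hC hp'),
    inv_mul_cancel_left₀ two_pi_I_ne_zero]
  · intro i hik h
    have := hC.eq_center hp' (Or.inl (mem_leftPoles_block.2 ⟨i, rfl⟩)) h
    exact hik (by exact_mod_cast neg_injective this)
  · intro i h
    have := hC.eq_center hp' (Or.inr (mem_rightPoles_block.2 ⟨i, rfl⟩)) h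
    exact hC.left_ne_right k i this.symm

lemma BarnesContour.Admissible.loop_right (hν : 0 < ν) (hx : 0 < x) (hy : 0 < y)
    (hC : C.Admissible (block11 (1 - a) (ν - a)) (block11 (1 + ν) 0) (block11 (-a) 0))
    {k : ℕ} (hp : ((-ν : ℝ) + k : ℂ) ∈ C.wrongRight (block11 (1 + ν) 0)) :
    C.loop (block11 (1 - a) (ν - a)) (block11 (1 + ν) 0) (block11 (-a) 0) x y ((-ν : ℝ) + k) =
      -(gammaResidue (-ν) k * ((x : ℂ) ^ (-((-ν : ℝ) + k : ℂ)) *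
        mellin (fun w => (innerDensity ν a y w : ℂ)) ((-ν : ℝ) + k))) := by
  have hp' := mem_union_right (C.wrongLeft (block11 (1 + ν) 0)) hp
  rw [BarnesContour.loop, circleIntegral.integral_congr hC.r_pos.le
    (fun z hz => hC.outerIntegrand_eq hy (Or.inr ⟨_, hp', hz⟩)),
    circleIntegral_gammaKernel_right hC.r_pos k (differentiableOn_cpow_mul_mellin hν hx hy hC hp'),
    mul_neg, inv_mul_cancel_left₀ two_pi_I_ne_zero]
  · intro i h
    have := hC.eq_center hp' (Or.inl (mem_leftPoles_block.2 ⟨i, rfl⟩)) h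
    exact hC.left_ne_right i k this
  · intro i hik h
    have := hC.eq_center hp' (Or.inr (mem_rightPoles_block.2 ⟨i, rfl⟩)) h
    exact hik (by exact_mod_cast add_left_cancel this)

lemma wrongLeft_eq_image {j l : ℕ} (h : WrongCount (-ν) C.c j l) :
    C.wrongLeft (block11 (1 + ν) 0) = (fun k : ℕ => (-k : ℂ)) '' (Finset.range j : Set ℕ) := by
  ext p
  simp only [BarnesContour.wrongLeft, mem_ofPred_eq, mem_leftPoles_block, mem_image, Finset.coe_range,
    mem_Iio]
  constructor
  · rintro ⟨⟨k, rfl⟩, hk⟩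
    exact ⟨k, (h.left k).2 (by simpa using hk), rfl⟩
  · rintro ⟨k, hk, rfl⟩
    exact ⟨⟨k, rfl⟩, by simpa using (h.left k).1 hk⟩

lemma wrongRight_eq_image {j l : ℕ} (h : WrongCount (-ν) C.c j l) :
    C.wrongRight (block11 (1 + ν) 0) =
      (fun k : ℕ => ((-ν : ℝ) + k : ℂ)) '' (Finset.range l : Set ℕ) := by
  ext p
  simp only [BarnesContour.wrongRight, mem_ofPred_eq, mem_rightPoles_block, mem_image,
    Finset.coe_range, mem_Iio]
  constructor
  · rintro ⟨⟨k, rfl⟩, hk⟩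
    exact ⟨k, (h.right k).2 (by simpa using hk), rfl⟩
  · rintro ⟨k, hk, rfl⟩
    exact ⟨⟨k, rfl⟩, by simpa using (h.right k).1 hk⟩

end Contour

/-- Writes a residue contribution as a Mellin integral at 0, so that it can be added under the
integral sign to the contribution of the line. -/
lemma hasMellin_mul_cpow {k : ℝ → ℂ} {p : ℂ} {x : ℝ} (hx : 0 < x) (hk : MellinConvergent k p)
    (ρ : ℂ) : HasMellin (fun w => k w * (ρ * ((x / w : ℝ) : ℂ) ^ (-p))) 0
      (ρ * ((x : ℂ) ^ (-p) * mellin k p)) := by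
  have e : ∀ w ∈ Ioi (0 : ℝ), (ρ * (x : ℂ) ^ (-p)) • ((w : ℂ) ^ (p - 1) • k w) =
      (w : ℂ) ^ ((0 : ℂ) - 1) • (k w * (ρ * ((x / w : ℝ) : ℂ) ^ (-p))) := by
    intro w hw
    have := cpow_neg_mul_cpow_add hx hw 0 p
    rw [zero_add] at this
    simp only [smul_eq_mul]
    linear_combination ρ * k w * this
  constructor
  · exact (integrable_congr ((ae_restrict_mem measurableSet_Ioi).mono fun w hw => e w hw)).1
      (hk.smul (ρ * (x : ℂ) ^ (-p)))
  · rw [mellin, ← setIntegral_congr_fun measurableSet_Ioi e, integral_smul, mellin, smul_eq_mul]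
    ring

lemma hasMellin_finset_sum {ι : Type*} (t : Finset ι) {f : ι → ℝ → ℂ} {s : ℂ} {m : ι → ℂ}
    (h : ∀ i ∈ t, HasMellin (f i) s (m i)) :
    HasMellin (fun w => ∑ i ∈ t, f i w) s (∑ i ∈ t, m i) := by
  have e : ∀ w : ℝ, (w : ℂ) ^ (s - 1) • ∑ i ∈ t, f i w = ∑ i ∈ t, (w : ℂ) ^ (s - 1) • f i w :=
    fun w => Finset.smul_sum
  constructor
  · simp only [MellinConvergent, e]
    exact integrable_finsetSum _ fun i hi => (h i hi).1
  · simp only [mellin, e]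
    rw [integral_finsetSum _ fun i hi => (h i hi).1]
    exact Finset.sum_congr rfl fun i hi => (h i hi).2

/-- All powers of w cancel: the exponents -1, ν - a, a + 1 and -ν add up to 0. -/
lemma innerDensity_mul_div {ν : ℝ} (a : ℕ) {x y w : ℝ} (hx : 0 < x) (hy : 0 < y)
    (hw : 0 < w) :
    w⁻¹ * (innerDensity ν a y w * (Real.Gamma (-ν) * (1 + x / w) ^ ν)) =
      Real.Gamma ν * Real.Gamma (-ν) * a.factorial *
        (((w + x) / (w + 1)) ^ ν * ((w + y) ^ (a + 1))⁻¹) := by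
  have h1 : 1 + x / w = (w + x) / w := by field_simp
  have h2 : 1 + y / w = (w + y) / w := by field_simp
  have h3 : w ^ (ν - a) = w ^ ν / w ^ a := by rw [Real.rpow_sub hw, Real.rpow_natCast]
  have h4 : (1 + y / w) ^ (-(1 + a : ℝ)) = ((w + y) ^ (a + 1) / w ^ (a + 1))⁻¹ := by
    rw [h2, Real.rpow_neg (by positivity), show (1 + a : ℝ) = ((a + 1 : ℕ) : ℝ) by push_cast; ring,
      Real.rpow_natCast, div_pow]
  have h5 : Real.Gamma (1 + a) = a.factorial := by rw [add_comm, Real.Gamma_nat_eq_factorial]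
  rw [innerDensity, h4, h1, h3, h5, Real.div_rpow (by positivity) hw.le,
    Real.div_rpow (by positivity) (by positivity), Real.rpow_neg (by positivity),
    add_comm 1 w]
  have p1 : 0 < w ^ ν := by positivity
  have p2 : 0 < (w + 1) ^ ν := by positivity
  field_simp
  ring

lemma mellin_innerDensity_mul {ν : ℝ} (a : ℕ) {x y : ℝ} (hx : 0 < x) (hy : 0 < y) :
    mellin (fun w => ((innerDensity ν a y w * (Real.Gamma (-ν) * (1 + x / w) ^ ν) : ℝ) : ℂ)) 0 =
      gFunctionValue ν a x y := by
  rw [gFunctionValue, ← integral_const_mul, ← integral_complex_ofReal, mellin]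
  refine setIntegral_congr_fun measurableSet_Ioi fun w hw => ?_
  rw [← innerDensity_mul_div a hx hy hw, zero_sub, cpow_neg_one, smul_eq_mul]
  push_cast
  rfl

/-! ### Independence of the contour and existence of admissible contours -/

section Contour

variable {ν : ℝ} {a : ℕ} {x y : ℝ} {C : BarnesContour}

lemma BarnesContour.Admissible.converges_and_value (hν : 0 < ν) (hν' : ∀ n : ℤ, ν ≠ n)
    (hx : 0 < x) (hy : 0 < y)
    (hC : C.Admissible (block11 (1 - a) (ν - a)) (block11 (1 + ν) 0) (block11 (-a) 0)) :
    C.Converges (block11 (1 - a) (ν - a)) (block11 (1 + ν) 0) (block11 (-a) 0) x y ∧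
    C.value (block11 (1 - a) (ν - a)) (block11 (1 + ν) 0) (block11 (-a) 0) x y =
      gFunctionValue ν a x y := by
  set K : ℝ → ℂ := fun w => (innerDensity ν a y w : ℂ) with hK
  have hline : ∀ u : ℝ, (C.c + u * I : ℂ) ∈ C.support (block11 (1 + ν) 0) := fun u =>
    Or.inl (by simp)
  have hav := hC.avoidsPoles
  obtain ⟨j, l, hcount⟩ : ∃ j l, WrongCount (-ν) C.c j l := ⟨_, _, wrongCount_ceil hav⟩
  have hstrip : -ν - 1 < C.c ∧ C.c < a := by
    obtain ⟨h1, h2, h3, h4⟩ := hC.mem_strip (hline 0)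
    simp at h1 h2 h3 h4
    constructor <;> linarith
  have hcv : MellinConvergent K (0 + C.c) :=
    mellinConvergent_innerDensity hν a hy (by simpa using hstrip.1) (by simpa using hstrip.2)
  -- Parseval at s = 0, now with the s-block in the role of φ and `innerDensity` in the role of k.
  obtain ⟨p1, p2, p3⟩ := mellin_parseval hcv (integrable_gammaKernel_line hav) hx
  have hout : ∀ u : ℝ, C.outerIntegrand (block11 (1 - a) (ν - a)) (block11 (1 + ν) 0)
      (block11 (-a) 0) x y (C.c + u * I) =
      mellin K (0 + (C.c + u * I)) * gammaKernel (-ν) (C.c + u * I) *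
        (x : ℂ) ^ (-(C.c + u * I : ℂ)) := by
    intro u
    rw [hC.outerIntegrand_eq hy (hline u), zero_add]
    ring
  refine ⟨⟨fun s hs => ?_, ?_, fun p hp => hC.circleIntegrable hν hx hy hp⟩, ?_⟩
  · obtain ⟨h1, h2, h3, h4⟩ := hC.mem_strip hs
    exact (inner_integral a hy h1 h2 h3 h4).1
  · simpa only [hout] using p1
  have hL : ∀ k < j, (-k : ℂ) ∈ C.wrongLeft (block11 (1 + ν) 0) := fun k hk => by
    rw [wrongLeft_eq_image hcount]
    exact ⟨k, by simpa using hk, rfl⟩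
  have hR : ∀ k < l, ((-ν : ℝ) + k : ℂ) ∈ C.wrongRight (block11 (1 + ν) 0) := fun k hk => by
    rw [wrongRight_eq_image hcount]
    exact ⟨k, by simpa using hk, rfl⟩
  have sumL : ∑ᶠ p ∈ C.wrongLeft (block11 (1 + ν) 0),
      C.loop (block11 (1 - a) (ν - a)) (block11 (1 + ν) 0) (block11 (-a) 0) x y p =
      ∑ k ∈ Finset.range j, (gammaResidue (-ν) k : ℂ) *
        ((x : ℂ) ^ (-(-k : ℂ)) * mellin K (-k)) := by
    rw [wrongLeft_eq_image hcount, finsum_mem_image, finsum_mem_coe_finset]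
    · exact Finset.sum_congr rfl fun k hk =>
        hC.loop_left hν hx hy (hL k (Finset.mem_range.1 hk))
    · intro k _ k' _ hkk
      exact_mod_cast neg_injective hkk
  have sumR : ∑ᶠ p ∈ C.wrongRight (block11 (1 + ν) 0),
      C.loop (block11 (1 - a) (ν - a)) (block11 (1 + ν) 0) (block11 (-a) 0) x y p =
      -∑ k ∈ Finset.range l, (gammaResidue (-ν) k : ℂ) *
        ((x : ℂ) ^ (-((-ν : ℝ) + k : ℂ)) * mellin K ((-ν : ℝ) + k)) := by
    rw [wrongRight_eq_image hcount, finsum_mem_image, finsum_mem_coe_finset,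
      ← Finset.sum_neg_distrib]
    · exact Finset.sum_congr rfl fun k hk =>
        hC.loop_right hν hx hy (hR k (Finset.mem_range.1 hk))
    · intro k _ k' _ hkk
      exact_mod_cast add_left_cancel hkk
  have mL := hasMellin_finset_sum (Finset.range j) (s := 0)
    (f := fun k w => K w * ((gammaResidue (-ν) k : ℂ) * ((x / w : ℝ) : ℂ) ^ (-(-k : ℂ))))
    fun k hk => by
      obtain ⟨h0, h1⟩ := hC.closedBall_strip (Or.inl (hL k (Finset.mem_range.1 hk)))
        (Metric.mem_closedBall_self hC.r_pos.le)
      exact hasMellin_mul_cpow hx (mellinConvergent_innerDensity hν a hy h0 h1) _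
  have mR := hasMellin_finset_sum (Finset.range l) (s := 0)
    (f := fun k w => K w * ((gammaResidue (-ν) k : ℂ) * ((x / w : ℝ) : ℂ) ^ (-((-ν : ℝ) + k : ℂ))))
    fun k hk => by
      obtain ⟨h0, h1⟩ := hC.closedBall_strip (Or.inr (hR k (Finset.mem_range.1 hk)))
        (Metric.mem_closedBall_self hC.r_pos.le)
      exact hasMellin_mul_cpow hx (mellinConvergent_innerDensity hν a hy h0 h1) _
  have mI := hasMellin_const_smul p2 (2 * Real.pi : ℂ)⁻¹
  have total := hasMellin_add (hasMellin_add mI.1 mL.1).1 mR.1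
  rw [BarnesContour.value, sumL, sumR, ← mL.2, ← mR.2, ← mellin_innerDensity_mul a hx hy]
  simp only [hout]
  -- The clockwise orientation of the right loops and the negative sign of their residues combine to
  -- a plus sign; line and loops merge into a single Mellin integral.
  rw [p3, ← smul_eq_mul, ← mI.2, sub_neg_eq_add, ← (hasMellin_add mI.1 mL.1).2, ← total.2]
  refine setIntegral_congr_fun measurableSet_Ioi fun w hw => ?_
  have hw : 0 < w := hw
  have hxw : 0 < x / w := div_pos hx hw
  have hb := barnesLine_eq hcount (fun n hn => hν' (-n) (by push_cast; linarith)) hxw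
  rw [barnesLine] at hb
  simp only [smul_eq_mul]
  congr 1
  rw [mul_left_comm _ (K w), hb, ← Finset.mul_sum, ← Finset.mul_sum, ← mul_add, ← mul_add,
    ofReal_mul]
  congr 1
  have e1 : ∀ k : ℕ, ((x / w : ℝ) : ℂ) ^ (-(-k : ℂ)) = (((x / w) ^ k : ℝ) : ℂ) := by
    intro k
    rw [neg_neg, cpow_natCast]
    push_cast
    rfl
  have e2 : ∀ k : ℕ, ((x / w : ℝ) : ℂ) ^ (-((-ν : ℝ) + k : ℂ)) =
      (((x / w) ^ (-(-ν) - k : ℝ) : ℝ) : ℂ) := by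
    intro k
    rw [ofReal_cpow hxw.le]
    congr 1
    push_cast
    ring
  simp only [e1, e2]
  -- The residue terms subtracted in the remainder cancel those of the loops, leaving Γ(-ν) (1 +
  -- x/w)^ν.
  simp only [barnesRemainder, neg_neg]
  push_cast
  ring

/-- With f the fractional part of -ν, the line Re s = f/2 lies to the right of every left pole, and
the right poles have real part in f + ℤ. Only right poles need loops, and a radius of at most a
quarter of min f (1 - f) keeps the circles off the line and off the other poles. -/
lemma exists_admissible (hν : 0 < ν) (hν' : ∀ n : ℤ, ν ≠ n) (ha : 1 ≤ a) :
    ∃ C : BarnesContour,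
      C.Admissible (block11 (1 - a) (ν - a)) (block11 (1 + ν) 0) (block11 (-a) 0) := by
  have ha' : (1 : ℝ) ≤ a := by exact_mod_cast ha
  set f : ℝ := Int.fract (-ν) with hf
  set m : ℤ := ⌊-ν⌋ with hm
  have hfm : -ν = m + f := (Int.floor_add_fract (-ν)).symm
  have f0 : 0 < f := by
    refine lt_of_le_of_ne (Int.fract_nonneg _) fun h0 => hν' (-m) ?_
    push_cast
    linarith
  have f1 : f < 1 := Int.fract_lt_one _
  set r : ℝ := min f (1 - f) / 4 with hr
  have r0 : 0 < r := by
    have : 0 < min f (1 - f) := lt_min f0 (by linarith)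
    positivity
  have rf : r ≤ f / 4 := by
    have := min_le_left f (1 - f)
    rw [hr]; linarith
  have rf' : r ≤ (1 - f) / 4 := by
    have := min_le_right f (1 - f)
    rw [hr]; linarith
  have intgap : ∀ n : ℤ, n ≠ 0 → (1 : ℝ) ≤ |(n : ℝ)| := fun n hn => by
    exact_mod_cast Int.one_le_abs hn
  have fgap : ∀ n : ℤ, r < |(n : ℝ) + f| := by
    intro n
    rcases lt_or_ge n 0 with hn | hn
    · have : (n : ℝ) ≤ -1 := by exact_mod_cast Int.le_sub_one_of_lt hn
      rw [abs_of_neg (by linarith)]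
      linarith
    · have : (0 : ℝ) ≤ n := by exact_mod_cast hn
      rw [abs_of_nonneg (by linarith)]
      linarith
  have halfgap : ∀ n : ℤ, r < |(n : ℝ) + f / 2| := by
    intro n
    rcases lt_or_ge n 0 with hn | hn
    · have : (n : ℝ) ≤ -1 := by exact_mod_cast Int.le_sub_one_of_lt hn
      rw [abs_of_neg (by linarith)]
      linarith
    · have : (0 : ℝ) ≤ n := by exact_mod_cast hn
      rw [abs_of_nonneg (by linarith)]
      linarith
  -- The midpoint of the interval of admissible real parts of t, which is nonempty exactly when -ν -
  -- 1 < Re s < a.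
  set D : ℂ → ℝ := fun s => (max 0 (a - ν - s.re) + min (1 + a : ℝ) (a - s.re)) / 2 with hD
  have hDs : ∀ s : ℂ, -ν - 1 < s.re → s.re < a →
      0 < D s ∧ D s < 1 + a ∧ a - ν < s.re + D s ∧ s.re + D s < a := by
    intro s h0 h1
    have key : max 0 (a - ν - s.re) < min (1 + a : ℝ) (a - s.re) := by
      rw [max_lt_iff, lt_min_iff, lt_min_iff]
      refine ⟨⟨?_, ?_⟩, ?_, ?_⟩ <;> linarith
    have k1 := le_max_left 0 (a - ν - s.re)
    have k2 := le_max_right 0 (a - ν - s.re)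
    have k3 := min_le_left (1 + a : ℝ) (a - s.re)
    have k4 := min_le_right (1 + a : ℝ) (a - s.re)
    simp only [hD]
    refine ⟨?_, ?_, ?_, ?_⟩ <;> linarith
  set C : BarnesContour := ⟨f / 2, r, D⟩ with hC
  have hwL : ∀ p, p ∉ C.wrongLeft (block11 (1 + ν) 0) := by
    rintro p ⟨hp, hpc⟩
    obtain ⟨k, rfl⟩ := mem_leftPoles_block.1 hp
    have : (0 : ℝ) ≤ k := k.cast_nonneg
    simp [hC] at hpc
    linarith
  have hwrong : ∀ p ∈ C.wrongLeft (block11 (1 + ν) 0) ∪ C.wrongRight (block11 (1 + ν) 0),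
      ∃ k : ℕ, p = ((-ν : ℝ) : ℂ) + k ∧ -ν + k < f / 2 := by
    rintro p (hp | ⟨hp, hpc⟩)
    · exact absurd hp (hwL p)
    · obtain ⟨k, rfl⟩ := mem_rightPoles_block.1 hp
      exact ⟨k, rfl, by simpa [hC] using hpc⟩
  have hsup : ∀ s ∈ C.support (block11 (1 + ν) 0), -ν - 1 < s.re ∧ s.re < a := by
    rintro s (hs | ⟨p, hp, hsp⟩)
    · have hs : s.re = f / 2 := hs
      rw [hs]
      constructor <;> linarith
    · obtain ⟨k, rfl, hk⟩ := hwrong p hp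
      have : (0 : ℝ) ≤ k := k.cast_nonneg
      have e3 : |(s - ((-ν : ℝ) + k : ℂ)).re| ≤ r :=
        (abs_re_le_norm _).trans (by rw [← dist_eq]; exact hsp.le)
      simp at e3
      rw [abs_le] at e3
      constructor <;> linarith
  refine ⟨C, r0, ?_, ?_, ?_, ?_, ?_, ?_, ?_, ?_⟩
  · rw [Set.disjoint_left]
    intro p hp hq
    obtain ⟨i, rfl⟩ := mem_leftPoles_block.1 hp
    obtain ⟨k, hk⟩ := mem_rightPoles_block.1 hq
    have := congrArg re hk
    simp at this
    exact hν' (i + k) (by push_cast; linarith)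
  · rintro p (hp | hp)
    · obtain ⟨k, rfl⟩ := mem_leftPoles_block.1 hp
      have : (0 : ℝ) ≤ k := k.cast_nonneg
      simp [hC]
      linarith
    · obtain ⟨k, rfl⟩ := mem_rightPoles_block.1 hp
      intro h
      have := halfgap (m + k)
      simp [hC] at h
      push_cast at this
      rw [show (m : ℝ) + k + f / 2 = 0 by linarith, abs_zero] at this
      linarith
  · intro p hp
    obtain ⟨k, rfl, -⟩ := hwrong p hp
    have := halfgap (m + k)
    push_cast at this
    simp only [hC, add_re, ofReal_re, natCast_re]
    rwa [show -ν + (k : ℝ) - f / 2 = (m : ℝ) + k + f / 2 by linarith]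
  · intro p hp q hq hqp
    obtain ⟨k, rfl, -⟩ := hwrong p hp
    rcases hq with hq | hq
    · obtain ⟨i, rfl⟩ := mem_leftPoles_block.1 hq
      have := fgap (m + k + i)
      have e3 : |((-i : ℂ) - ((-ν : ℝ) + k : ℂ)).re| ≤ dist (-i : ℂ) ((-ν : ℝ) + k : ℂ) :=
        (abs_re_le_norm _).trans (by rw [← dist_eq])
      refine lt_of_lt_of_le ?_ e3
      rw [← abs_neg]
      simp only [sub_re, neg_re, add_re, ofReal_re, natCast_re]
      push_cast at this
      rwa [show -(-(i : ℝ) - (-ν + k)) = (m : ℝ) + k + i + f by linarith]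
    · obtain ⟨i, rfl⟩ := mem_rightPoles_block.1 hq
      have hik : (i : ℤ) - k ≠ 0 := by
        intro h
        have : i = k := by lia
        exact hqp (by rw [this])
      have := intgap _ hik
      have e3 : |(((-ν : ℝ) + i : ℂ) - ((-ν : ℝ) + k : ℂ)).re| ≤
          dist ((-ν : ℝ) + i : ℂ) ((-ν : ℝ) + k : ℂ) :=
        (abs_re_le_norm _).trans (by rw [← dist_eq])
      refine lt_of_lt_of_le ?_ e3
      simp only [sub_re, add_re, ofReal_re, natCast_re]
      push_cast at this
      rw [show -ν + (i : ℝ) - (-ν + k) = (i : ℝ) - k by ring]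
      change r < _
      linarith
  · intro s hs p hp
    rw [block11_leftPoles] at hp
    obtain ⟨k, rfl⟩ := hp
    have : (0 : ℝ) ≤ k := k.cast_nonneg
    have h := hDs s (hsup s hs).1 (hsup s hs).2
    simp [hC]
    linarith
  · intro s hs p hp
    rw [block11_rightPoles] at hp
    obtain ⟨k, rfl⟩ := hp
    have : (0 : ℝ) ≤ k := k.cast_nonneg
    have h := hDs s (hsup s hs).1 (hsup s hs).2
    simp [hC]
    linarith
  · intro s hs p hp
    rw [block11_leftPoles] at hp
    obtain ⟨k, rfl⟩ := hp
    have : (0 : ℝ) ≤ k := k.cast_nonneg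
    have h := hDs s (hsup s hs).1 (hsup s hs).2
    simp [hC]
    linarith
  · intro s hs p hp
    rw [block11_rightPoles] at hp
    obtain ⟨k, rfl⟩ := hp
    have : (0 : ℝ) ≤ k := k.cast_nonneg
    have h := hDs s (hsup s hs).1 (hsup s hs).2
    simp [hC]
    linarith

theorem isEGBMGF_gFunctionValue (hν : 0 < ν) (hν' : ∀ n : ℤ, ν ≠ n) (ha : 1 ≤ a)
    (hx : 0 < x) (hy : 0 < y) :
    IsEGBMGF (block11 (1 - a) (ν - a)) (block11 (1 + ν) 0) (block11 (-a) 0) x y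
      (gFunctionValue ν a x y) :=
  ⟨exists_admissible hν hν' ha, fun _ hC => hC.converges_and_value hν hν' hx hy⟩

/-- Existence of one admissible contour forces uniqueness of the value, so the chosen witness is v.
-/
lemma egbmgf_eq {P₁ P₂ P₃ : MeijerBlock} {v : ℂ} (h : IsEGBMGF P₁ P₂ P₃ x y v) :
    egbmgf P₁ P₂ P₃ x y = v := by
  have hex : ∃ v, IsEGBMGF P₁ P₂ P₃ x y v := ⟨v, h⟩
  rw [egbmgf, dif_pos hex]
  obtain ⟨C, hC⟩ := h.1
  rw [← (hex.choose_spec.2 C hC).2, (h.2 C hC).2]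

end Contour

/-! ### Gamma laws with integer shape -/

/-- `e^{-zx} ∑_{k ≤ n} (zx)^k / k!`. -/
def erlangTail (z : ℂ) (n : ℕ) (x : ℝ) : ℂ :=
  exp (-(z * x)) * ∑ k ∈ Finset.range (n + 1), (z * x) ^ k / k.factorial

/-- The derivative telescopes in n. The complex rate serves two purposes: z = r gives tail
probabilities, z = r - it the characteristic function. -/
lemma hasDerivAt_erlangTail (z : ℂ) (n : ℕ) (x : ℝ) :
    HasDerivAt (erlangTail z n) (-(z * (z * x) ^ n / n.factorial * exp (-(z * x)))) x := by
  have hlin : HasDerivAt (fun x : ℝ => z * (x : ℂ)) z x := by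
    simpa using (hasDerivAt_id (x : ℂ)).comp_ofReal.const_mul z
  have hexp : HasDerivAt (fun x : ℝ => exp (-(z * x))) (exp (-(z * x)) * -z) x := hlin.neg.cexp
  induction n with
  | zero =>
    convert! hexp using 1
    · ext x; simp [erlangTail]
    · simp
      ring
  | succ n ih =>
    have h2 := ih.add (hexp.mul ((hlin.pow (n + 1)).div_const ((n + 1).factorial : ℂ)))
    convert! h2 using 1
    · ext x
      simp only [erlangTail, Pi.add_apply, Pi.mul_apply, Pi.pow_apply]
      rw [Finset.sum_range_succ _ (n + 1)]
      ring
    · have : (n.factorial : ℂ) ≠ 0 := by exact_mod_cast n.factorial_ne_zero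
      have : (n + 1 : ℂ) ≠ 0 := by exact_mod_cast n.succ_ne_zero
      rw [Nat.factorial_succ]
      push_cast
      simp only [Pi.pow_apply]
      field_simp
      ring

lemma tendsto_pow_mul_exp_neg_mul {z : ℂ} (hz : 0 < z.re) (k : ℕ) :
    Tendsto (fun x : ℝ => (x : ℂ) ^ k * exp (-(z * x))) atTop (𝓝 0) := by
  rw [tendsto_zero_iff_norm_tendsto_zero]
  have := tendsto_rpow_mul_exp_neg_mul_atTop_nhds_zero k z.re hz
  refine this.congr' ?_
  filter_upwards [eventually_ge_atTop 0] with x hx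
  rw [norm_mul, norm_exp, norm_pow, Complex.norm_real, Real.norm_of_nonneg hx, Real.rpow_natCast]
  simp

lemma tendsto_erlangTail {z : ℂ} (hz : 0 < z.re) (n : ℕ) :
    Tendsto (erlangTail z n) atTop (𝓝 0) := by
  have : Tendsto (fun x : ℝ => ∑ k ∈ Finset.range (n + 1),
      z ^ k / k.factorial * ((x : ℂ) ^ k * exp (-(z * x)))) atTop
      (𝓝 (∑ k ∈ Finset.range (n + 1), z ^ k / k.factorial * 0)) :=
    tendsto_finsetSum _ fun k _ => (tendsto_pow_mul_exp_neg_mul hz k).const_mul _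
  simp only [mul_zero, Finset.sum_const_zero] at this
  refine this.congr fun x => ?_
  rw [erlangTail, Finset.mul_sum]
  refine Finset.sum_congr rfl fun k _ => ?_
  ring

lemma integrableOn_erlang {z : ℂ} (hz : 0 < z.re) (n : ℕ) :
    IntegrableOn (fun x : ℝ => z * (z * x) ^ n / n.factorial * exp (-(z * x))) (Ioi 0) := by
  have h1 : IntegrableOn (fun x : ℝ => x ^ (n : ℝ) * Real.exp (-z.re * x ^ (1 : ℝ))) (Ioi 0) :=
    integrableOn_rpow_mul_exp_neg_mul_rpow (by linarith [n.cast_nonneg (α := ℝ)])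
      one_pos hz
  have h2 : IntegrableOn (fun x : ℝ => (x : ℂ) ^ n * exp (-(z * x))) (Ioi 0) := by
    refine Integrable.mono' h1 (by fun_prop) ?_
    filter_upwards [ae_restrict_mem measurableSet_Ioi] with x hx
    have hx : 0 < x := hx
    rw [norm_mul, norm_exp, norm_pow, Complex.norm_real, Real.norm_of_nonneg hx.le,
      Real.rpow_natCast, Real.rpow_one]
    simp
  refine (h2.const_mul (z * z ^ n / n.factorial)).congr (ae_of_all _ fun x => ?_)
  simp only [mul_pow]
  ring

lemma integral_erlang {z : ℂ} (hz : 0 < z.re) (n : ℕ) {a : ℝ} (ha : 0 ≤ a) :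
    ∫ x : ℝ in Ioi a, z * (z * x) ^ n / n.factorial * exp (-(z * x)) = erlangTail z n a := by
  have := integral_Ioi_of_hasDerivAt_of_tendsto' (a := a)
    (fun x _ => hasDerivAt_erlangTail z n x)
    (((integrableOn_erlang hz n).mono_set (Ioi_subset_Ioi ha)).neg) (tendsto_erlangTail hz n)
  rw [integral_neg] at this
  linear_combination -this

lemma gammaPDFReal_succ (n : ℕ) (r : ℝ) {x : ℝ} (hx : 0 ≤ x) :
    gammaPDFReal (n + 1 : ℕ) r x = r * (r * x) ^ n / n.factorial * Real.exp (-(r * x)) := by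
  rw [gammaPDFReal, if_pos hx]
  push_cast
  rw [Real.Gamma_nat_eq_factorial, add_sub_cancel_right, Real.rpow_natCast, mul_pow,
    ← Nat.cast_succ, Real.rpow_natCast, pow_succ]
  ring

lemma gammaMeasure_eq_restrict (N r : ℝ) :
    gammaMeasure N r = (volume.restrict (Ioi 0)).withDensity (gammaPDF N r) := by
  rw [gammaMeasure, restrict_Ioi_eq_restrict_Ici, ← restrict_withDensity measurableSet_Ici]
  symm
  refine Measure.restrict_eq_self_of_ae_mem ?_
  rw [ae_iff]
  change volume.withDensity _ (Ici 0)ᶜ = 0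
  rw [compl_Ici, withDensity_apply _ measurableSet_Iio]
  exact lintegral_gammaPDF_of_nonpos le_rfl

lemma measurable_gammaPDF (N r : ℝ) : Measurable (gammaPDF N r) :=
  (measurable_gammaPDFReal N r).ennreal_ofReal

lemma lintegral_gammaMeasure (N r : ℝ) {f : ℝ → ENNReal} (hf : Measurable f) :
    ∫⁻ x, f x ∂gammaMeasure N r = ∫⁻ x in Ioi 0, gammaPDF N r x * f x := by
  rw [gammaMeasure_eq_restrict,
    lintegral_withDensity_eq_lintegral_mul _ (measurable_gammaPDF N r) hf]
  rfl

lemma charFun_gammaMeasure (n : ℕ) {r : ℝ} (hr : 0 < r) (t : ℝ) :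
    charFun (gammaMeasure (n + 1 : ℕ) r) t = (r / (r - t * I)) ^ (n + 1) := by
  have hre : 0 < ((r : ℂ) - t * I).re := by simpa using hr
  have hne : ((r : ℂ) - t * I) ≠ 0 := fun h => by simp [h] at hre
  have hT := integral_erlang hre n le_rfl
  have h0 : erlangTail ((r : ℂ) - t * I) n 0 = 1 := by
    simp [erlangTail, Finset.sum_range_succ']
  rw [h0] at hT
  rw [charFun_apply_real, gammaMeasure_eq_restrict,
    integral_withDensity_eq_integral_toReal_smul (measurable_gammaPDF _ _)
      (ae_of_all _ fun _ => ENNReal.ofReal_lt_top)]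
  rw [← mul_one ((r / (r - t * I) : ℂ) ^ (n + 1)), ← hT, ← integral_const_mul]
  refine setIntegral_congr_fun measurableSet_Ioi fun x hx => ?_
  have hx : 0 < x := hx
  have hG : (gammaPDF (n + 1 : ℕ) r x).toReal =
      r * (r * x) ^ n / n.factorial * Real.exp (-(r * x)) := by
    rw [gammaPDF, gammaPDFReal_succ n r hx.le, ENNReal.toReal_ofReal (by positivity)]
  rw [hG, real_smul]
  push_cast
  have e : exp (-(((r : ℂ) - t * I) * x)) = exp (-(r * x)) * exp (t * x * I) := by
    rw [← exp_add]
    congr 1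
    ring
  rw [e, mul_pow ((r : ℂ) - t * I), div_pow, pow_succ ((r : ℂ) - t * I), mul_pow (r : ℂ)]
  have : (n.factorial : ℂ) ≠ 0 := by exact_mod_cast n.factorial_ne_zero
  field_simp
  ring

/-! ### Channel gains -/

/-- The square is what two independent coordinates contribute, and it removes the branch of the
square root in the Gaussian integral. -/
lemma integral_exp_sq_gaussianReal (t : ℝ) :
    (∫ x : ℝ, exp (t * (x : ℂ) ^ 2 * I) ∂gaussianReal 0 (1 / 2)) ^ 2 = (1 - t * I)⁻¹ := by
  have hre : 0 < (1 - t * I : ℂ).re := by simp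
  have hne : (1 - t * I : ℂ) ≠ 0 := fun h => by simp [h] at hre
  rw [integral_gaussianReal_eq_integral_smul (by simp)]
  have e : ∀ x : ℝ, gaussianPDFReal 0 (1 / 2) x • exp (t * (x : ℂ) ^ 2 * I) =
      ((√Real.pi)⁻¹ : ℝ) * exp (-(1 - t * I) * (x : ℂ) ^ 2) := by
    intro x
    have h2 : 2 * Real.pi * ((1 / 2 : NNReal) : ℝ) = Real.pi := by
      push_cast
      ring
    rw [gaussianPDFReal, real_smul, h2]
    push_cast
    rw [mul_assoc, ← exp_add]
    congr 2
    field_simp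
    ring
  simp only [e]
  rw [integral_const_mul, integral_gaussian_complex hre, mul_pow, ← cpow_nat_mul]
  rw [← ofReal_pow, inv_pow, Real.sq_sqrt Real.pi_pos.le]
  simp only [Nat.cast_ofNat, ne_eq, OfNat.ofNat_ne_zero, not_false_eq_true,
    one_div, mul_inv_cancel₀, cpow_one]
  have : (Real.pi : ℂ) ≠ 0 := ofReal_ne_zero.2 Real.pi_ne_zero
  push_cast
  field_simp

lemma integral_exp_normSq_stdComplexGaussian (t : ℝ) :
    ∫ z, exp (t * (‖z‖ ^ 2 : ℝ) * I) ∂stdComplexGaussian = (1 - t * I)⁻¹ := by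
  rw [stdComplexGaussian, integral_map_equiv, ← integral_exp_sq_gaussianReal, sq,
    ← integral_prod_mul]
  congr 1
  ext p
  rw [← exp_add, ← normSq_eq_norm_sq, normSq_apply]
  congr 1
  simp [measurableEquivRealProd_symm_apply]
  ring

section Gain

variable {E : Type*} [MeasurableSpace E] {P : Measure E}

lemma charFun_gain {h : E → ℂ} (hlaw : HasLaw h stdComplexGaussian P) {Ω : ℝ} (hΩ : 0 < Ω)
    (t : ℝ) : charFun (P.map fun ω => ‖(√Ω : ℂ) * h ω‖ ^ 2) t =
      (1 / Ω : ℝ) / ((1 / Ω : ℝ) - t * I) := by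
  have hm := hlaw.aemeasurable
  rw [charFun_apply_real, integral_map (by fun_prop) (by fun_prop)]
  have hl : ∫ ω, exp (t * (‖(√Ω : ℂ) * h ω‖ ^ 2 : ℝ) * I) ∂P =
      ∫ z, exp (t * (‖(√Ω : ℂ) * z‖ ^ 2 : ℝ) * I) ∂stdComplexGaussian := by
    rw [← hlaw.map_eq, integral_map hm (by fun_prop)]
  rw [hl]
  have e : ∀ z : ℂ, exp (t * (‖(√Ω : ℂ) * z‖ ^ 2 : ℝ) * I) =
      exp ((t * Ω : ℝ) * (‖z‖ ^ 2 : ℝ) * I) := by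
    intro z
    rw [norm_mul, mul_pow, Complex.norm_real, Real.norm_of_nonneg (Real.sqrt_nonneg _),
      Real.sq_sqrt hΩ.le]
    push_cast
    congr 1
    ring
  simp only [e]
  rw [integral_exp_normSq_stdComplexGaussian]
  have h1 : (Ω : ℂ) ≠ 0 := ofReal_ne_zero.2 hΩ.ne'
  have h2 : (1 - (t * Ω : ℝ) * I : ℂ) ≠ 0 := fun h => by simpa using congrArg re h
  have h3 : ((1 / Ω : ℝ) - t * I : ℂ) = (1 - (t * Ω : ℝ) * I) / Ω := by
    push_cast
    field_simp
  rw [h3]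
  push_cast at h2 ⊢
  field_simp

/-- Each summand is exponential with rate 1/Ω; the characteristic function of the independent sum is
the corresponding power, which determines the law. -/
lemma hasLaw_sum_gain {ι : Type*} [Fintype ι] [IsProbabilityMeasure P] {h : ι → E → ℂ}
    (hlaw : ∀ i, HasLaw (h i) stdComplexGaussian P) (hind : iIndepFun h P) {Ω : ℝ} (hΩ : 0 < Ω)
    {N : ℕ} (hN : Fintype.card ι = N) (hN1 : 1 ≤ N) :
    HasLaw (fun ω => ∑ i, ‖(√Ω : ℂ) * h i ω‖ ^ 2) (gammaMeasure N (1 / Ω)) P := by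
  obtain ⟨n, rfl⟩ : ∃ n, N = n + 1 := ⟨N - 1, by lia⟩
  have hr : 0 < 1 / Ω := by positivity
  have hm : ∀ i, AEMeasurable (h i) P := fun i => (hlaw i).aemeasurable
  have hms : AEMeasurable (fun ω => ∑ i, ‖(√Ω : ℂ) * h i ω‖ ^ 2) P :=
    Finset.aemeasurable_fun_sum _ fun i _ => by
      have := hm i
      fun_prop
  have : IsProbabilityMeasure (gammaMeasure (n + 1 : ℕ) (1 / Ω)) :=
    isProbabilityMeasure_gammaMeasure (by positivity) hr
  have : IsProbabilityMeasure (P.map fun ω => ∑ i, ‖(√Ω : ℂ) * h i ω‖ ^ 2) :=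
    Measure.isProbabilityMeasure_map hms
  refine ⟨hms, Measure.ext_of_charFun ?_⟩
  have hind' : iIndepFun (fun i ω => ‖(√Ω : ℂ) * h i ω‖ ^ 2) P :=
    hind.comp (fun _ z => ‖(√Ω : ℂ) * z‖ ^ 2) fun _ => by fun_prop
  rw [hind'.charFun_map_fun_sum_eq_prod fun i => by have := hm i; fun_prop]
  ext t
  rw [charFun_gammaMeasure n hr, Finset.prod_apply]
  simp only [charFun_gain (hlaw _) hΩ]
  rw [Finset.prod_const, Finset.card_univ, hN]

end Gain

/-! ### Expectations of functions of a ratio of gains -/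

lemma ofReal_erlangTail (r : ℝ) (n : ℕ) (x : ℝ) : erlangTail r n x =
    ((Real.exp (-(r * x)) * ∑ k ∈ Finset.range (n + 1), (r * x) ^ k / k.factorial : ℝ) : ℂ) := by
  rw [erlangTail]
  push_cast
  rfl

lemma gammaMeasure_Ioi (n : ℕ) {r z : ℝ} (hr : 0 < r) (hz : 0 ≤ z) :
    gammaMeasure (n + 1 : ℕ) r (Ioi z) = ENNReal.ofReal
      (Real.exp (-(r * z)) * ∑ k ∈ Finset.range (n + 1), (r * z) ^ k / k.factorial) := by
  have hre : 0 < (r : ℂ).re := by simpa using hr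
  have e : ∀ x : ℝ, (r : ℂ) * (r * x) ^ n / n.factorial * exp (-(r * x)) =
      ((r * (r * x) ^ n / n.factorial * Real.exp (-(r * x)) : ℝ) : ℂ) := by
    intro x
    push_cast
    rfl
  have h1 := integral_erlang hre n hz
  have h2 := (integrableOn_erlang hre n).mono_set (Ioi_subset_Ioi hz)
  simp only [e] at h1 h2
  rw [integral_complex_ofReal, ofReal_erlangTail] at h1
  rw [← ofReal_injective h1, ofReal_integral_eq_lintegral_ofReal (by exact_mod_cast h2.re),
    gammaMeasure, withDensity_apply _ measurableSet_Ioi]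
  · refine setLIntegral_congr_fun measurableSet_Ioi fun x hx => ?_
    rw [gammaPDF, gammaPDFReal_succ n r (hz.trans (le_of_lt hx))]
  · filter_upwards [ae_restrict_mem measurableSet_Ioi] with x hx
    have : 0 < x := lt_of_le_of_lt hz hx
    simp only [Pi.zero_apply]
    positivity

lemma gammaMeasure_Ici (N r z : ℝ) : gammaMeasure N r (Ici z) = gammaMeasure N r (Ioi z) := by
  rw [gammaMeasure, withDensity_apply _ measurableSet_Ici, withDensity_apply _ measurableSet_Ioi,
    restrict_Ioi_eq_restrict_Ici]

/-- Splits according to which coordinate is smaller. Ties go to the second coordinate, hence the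
closed half-line in the second term. -/
lemma lintegral_min_prod (μ₁ μ₂ : Measure ℝ) [SFinite μ₁] [SFinite μ₂] {H : ℝ → ENNReal}
    (hH : Measurable H) :
    ∫⁻ p, H (min p.1 p.2) ∂(μ₁.prod μ₂) =
      ∫⁻ z, H z * μ₂ (Ioi z) ∂μ₁ + ∫⁻ z, H z * μ₁ (Ici z) ∂μ₂ := by
  have hs : MeasurableSet {p : ℝ × ℝ | p.1 < p.2} := measurableSet_lt measurable_fst measurable_snd
  have e : ∀ p : ℝ × ℝ, H (min p.1 p.2) =
      {p : ℝ × ℝ | p.1 < p.2}.indicator (fun p => H p.1) p +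
      {p : ℝ × ℝ | p.1 < p.2}ᶜ.indicator (fun p => H p.2) p := by
    intro p
    by_cases h : p.1 < p.2
    · simp [h, h.le]
    · simp [h, not_lt.1 h]
  simp only [e]
  have m1 : Measurable ({p : ℝ × ℝ | p.1 < p.2}.indicator fun p => H p.1) :=
    (hH.comp measurable_fst).indicator hs
  have m2 : Measurable ({p : ℝ × ℝ | p.1 < p.2}ᶜ.indicator fun p => H p.2) :=
    (hH.comp measurable_snd).indicator hs.compl
  rw [lintegral_add_left m1, lintegral_prod _ m1.aemeasurable, lintegral_prod_symm _ m2.aemeasurable]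
  congr 1
  · refine lintegral_congr fun z => ?_
    rw [← setLIntegral_const, ← lintegral_indicator measurableSet_Ioi]
    rfl
  · refine lintegral_congr fun z => ?_
    rw [← setLIntegral_const, ← lintegral_indicator measurableSet_Ici]
    refine lintegral_congr fun u => ?_
    simp [indicator_apply]

/-- For shape 1 the gamma law is exponential, so at fixed z the ratio w = κ p / z is exponential
with rate (r / κ) z. -/
lemma lintegral_exp_ratio {r κ z : ℝ} (hκ : 0 < κ) (hz : 0 < z)
    {f g : ℝ → ENNReal} (hf : Measurable f) (hfg : ∀ p, 0 < p → f p = g (κ * p / z)) :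
    ∫⁻ p, f p ∂gammaMeasure (1 : ℕ) r =
      ∫⁻ w in Ioi 0, ENNReal.ofReal (r / κ * z * Real.exp (-(r / κ * z * w))) * g w := by
  have himg : (fun w : ℝ => z / κ * w) '' Ioi 0 = Ioi 0 := by
    rw [image_mul_left_Ioi (div_pos hz hκ), mul_zero]
  rw [lintegral_gammaMeasure _ _ hf, ← himg, lintegral_image_eq_lintegral_abs_deriv_mul
    (f' := fun _ => z / κ) measurableSet_Ioi
    (fun w _ => by simpa using ((hasDerivAt_id w).const_mul (z / κ)).hasDerivWithinAt)
    ((mul_right_injective₀ (div_pos hz hκ).ne').injOn), himg]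
  refine setLIntegral_congr_fun measurableSet_Ioi fun w hw => ?_
  have hw : 0 < w := hw
  have hp : 0 < z / κ * w := by positivity
  rw [hfg _ hp, gammaPDF, gammaPDFReal_succ 0 r hp.le, abs_of_pos (div_pos hz hκ), ← mul_assoc,
    ← ENNReal.ofReal_mul (by positivity)]
  congr 2
  · simp only [pow_zero, Nat.factorial_zero, Nat.cast_one]
    rw [show r * (z / κ * w) = r / κ * z * w by ring]
    ring
  · field_simp

lemma lintegral_pow_mul_exp_neg (n : ℕ) {s : ℝ} (hs : 0 < s) :
    ∫⁻ z in Ioi 0, ENNReal.ofReal (z ^ n * Real.exp (-(s * z))) =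
      ENNReal.ofReal (n.factorial * (s ^ (n + 1))⁻¹) := by
  have h := lintegral_gammaPDF_eq_one (a := (n + 1 : ℕ)) (by positivity) hs
  have h0 : gammaMeasure (n + 1 : ℕ) s univ = 1 := by
    rw [gammaMeasure, withDensity_apply _ MeasurableSet.univ, Measure.restrict_univ, h]
  rw [gammaMeasure_eq_restrict, withDensity_apply _ MeasurableSet.univ, Measure.restrict_univ] at h0
  have e : ∀ z ∈ Ioi (0 : ℝ), ENNReal.ofReal (z ^ n * Real.exp (-(s * z))) =
      ENNReal.ofReal (n.factorial * (s ^ (n + 1))⁻¹) * gammaPDF (n + 1 : ℕ) s z := by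
    intro z hz
    rw [gammaPDF, gammaPDFReal_succ n s (le_of_lt hz), ← ENNReal.ofReal_mul (by positivity)]
    congr 1
    rw [mul_pow, pow_succ]
    field_simp
  rw [setLIntegral_congr_fun measurableSet_Ioi e,
    lintegral_const_mul _ (measurable_gammaPDF _ _), h0, mul_one]

/-! ### Reduction of the expectation to one-dimensional integrals -/

section Term

variable {φ : ℝ → ℝ}

lemma integrableOn_mul_inv_pow (hφ : Measurable φ) (hφ0 : ∀ w, 0 < w → 0 < φ w)
    (hφ1 : ∀ w, 0 < w → φ w ≤ 1) (b : ℕ) {y : ℝ} (hy : 0 < y) :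
    IntegrableOn (fun w => φ w * ((w + y) ^ (b + 2))⁻¹) (Ioi 0) := by
  have h := integrableOn_add_rpow_Ioi_of_lt (a := -(b + 2 : ℕ)) (c := 0) (m := y)
    (by push_cast; linarith [b.cast_nonneg (α := ℝ)]) (by linarith)
  refine Integrable.mono' h (by fun_prop) ?_
  filter_upwards [ae_restrict_mem measurableSet_Ioi] with w hw
  have hw : 0 < w := hw
  have := hφ0 w hw
  rw [Real.norm_of_nonneg (by positivity), Real.rpow_neg (by positivity), Real.rpow_natCast]
  exact mul_le_of_le_one_left (by positivity) (hφ1 w hw)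

lemma integral_mul_inv_pow_pos (hφ : Measurable φ) (hφ0 : ∀ w, 0 < w → 0 < φ w)
    (hφ1 : ∀ w, 0 < w → φ w ≤ 1) (b : ℕ) {y : ℝ} (hy : 0 < y) :
    0 < ∫ w in Ioi 0, φ w * ((w + y) ^ (b + 2))⁻¹ := by
  have hpos : ∀ w ∈ Ioi (0 : ℝ), 0 < φ w * ((w + y) ^ (b + 2))⁻¹ := by
    intro w hw
    have hw : 0 < w := hw
    have := hφ0 w hw
    positivity
  rw [setIntegral_pos_iff_support_of_nonneg_ae _ (integrableOn_mul_inv_pow hφ hφ0 hφ1 b hy)]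
  · have : Ioi (0 : ℝ) ⊆ Function.support (fun w => φ w * ((w + y) ^ (b + 2))⁻¹) ∩ Ioi 0 :=
      fun w hw => ⟨(hpos w hw).ne', hw⟩
    exact lt_of_lt_of_le (by simp) (measure_mono this)
  · filter_upwards [ae_restrict_mem measurableSet_Ioi] with w hw using (hpos w hw).le

/-- By Tonelli the z-integral comes first: it is a gamma integral of z^(b+1) with rate c (w + y).
Its factor c^(-(b+2)) meets the c from the exponential density. -/
lemma lintegral_pow_exp_mul_ratio (hφ : Measurable φ) (hφ0 : ∀ w, 0 < w → 0 < φ w)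
    (hφ1 : ∀ w, 0 < w → φ w ≤ 1) (b : ℕ) {A c y : ℝ} (hA : 0 ≤ A) (hc : 0 < c) (hy : 0 < y) :
    ∫⁻ z in Ioi 0, ENNReal.ofReal (A * z ^ b * Real.exp (-(c * y * z))) *
      ∫⁻ w in Ioi 0, ENNReal.ofReal (c * z * Real.exp (-(c * z * w))) * ENNReal.ofReal (φ w) =
    ENNReal.ofReal (A * (c ^ (b + 1))⁻¹ * (b + 1).factorial *
      ∫ w in Ioi 0, φ w * ((w + y) ^ (b + 2))⁻¹) := by
  have step : ∀ z ∈ Ioi (0 : ℝ), ENNReal.ofReal (A * z ^ b * Real.exp (-(c * y * z))) *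
      (∫⁻ w in Ioi 0, ENNReal.ofReal (c * z * Real.exp (-(c * z * w))) * ENNReal.ofReal (φ w)) =
      ∫⁻ w in Ioi 0, ENNReal.ofReal (φ w * (A * c)) *
        ENNReal.ofReal (z ^ (b + 1) * Real.exp (-(c * (w + y) * z))) := by
    intro z hz
    have hz : 0 < z := hz
    rw [← lintegral_const_mul _ (by fun_prop)]
    refine setLIntegral_congr_fun measurableSet_Ioi fun w hw => ?_
    have hw : 0 < w := hw
    have := hφ0 w hw
    rw [← ENNReal.ofReal_mul (by positivity), ← ENNReal.ofReal_mul (by positivity),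
      ← ENNReal.ofReal_mul (by positivity)]
    congr 1
    rw [show -(c * (w + y) * z) = -(c * y * z) + -(c * z * w) by ring, Real.exp_add]
    ring
  rw [setLIntegral_congr_fun measurableSet_Ioi step, lintegral_lintegral_swap (by fun_prop)]
  have inner : ∀ w ∈ Ioi (0 : ℝ), ∫⁻ z in Ioi 0, ENNReal.ofReal (φ w * (A * c)) *
        ENNReal.ofReal (z ^ (b + 1) * Real.exp (-(c * (w + y) * z))) =
      ENNReal.ofReal (A * (c ^ (b + 1))⁻¹ * (b + 1).factorial *
        (φ w * ((w + y) ^ (b + 2))⁻¹)) := by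
    intro w hw
    have hw : 0 < w := hw
    have := hφ0 w hw
    rw [lintegral_const_mul _ (by fun_prop), lintegral_pow_mul_exp_neg _ (by positivity),
      ← ENNReal.ofReal_mul (by positivity)]
    congr 1
    rw [mul_pow, pow_succ c (b + 1)]
    field_simp
  rw [setLIntegral_congr_fun measurableSet_Ioi inner, ← integral_const_mul,
    ofReal_integral_eq_lintegral_ofReal]
  · exact (integrableOn_mul_inv_pow hφ hφ0 hφ1 b hy).const_mul _
  · filter_upwards [ae_restrict_mem measurableSet_Ioi] with w hw
    have hw : 0 < w := hw
    have := hφ0 w hw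
    simp only [Pi.zero_apply]
    positivity

/-- The tail of the larger gain is expanded into its monomials, indexed by τ; its exponential
combines with that of the density into rate r₁ + r₂ = c y. -/
lemma lintegral_mul_gammaMeasure_Ioi (hφ : Measurable φ) (hφ0 : ∀ w, 0 < w → 0 < φ w)
    (hφ1 : ∀ w, 0 < w → φ w ≤ 1) (n m : ℕ) {r₁ r₂ c y : ℝ} (hr₁ : 0 < r₁) (hr₂ : 0 < r₂)
    (hc : 0 < c) (hy : 0 < y) (hcy : r₁ + r₂ = c * y) {H : ℝ → ENNReal} (hH : Measurable H)
    (hHz : ∀ z, 0 < z → H z = ∫⁻ w in Ioi 0,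
      ENNReal.ofReal (c * z * Real.exp (-(c * z * w))) * ENNReal.ofReal (φ w)) :
    ∫⁻ z, H z * gammaMeasure (m + 1 : ℕ) r₂ (Ioi z) ∂gammaMeasure (n + 1 : ℕ) r₁ =
    ENNReal.ofReal (∑ τ ∈ Finset.range (m + 1),
      r₁ ^ (n + 1) * r₂ ^ τ / (n.factorial * τ.factorial) * (c ^ (n + τ + 1))⁻¹ *
        (n + τ + 1).factorial * ∫ w in Ioi 0, φ w * ((w + y) ^ (n + τ + 2))⁻¹) := by
  have htail : Measurable fun z => gammaMeasure (m + 1 : ℕ) r₂ (Ioi z) :=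
    Antitone.measurable fun z z' h => measure_mono (Ioi_subset_Ioi h)
  rw [lintegral_gammaMeasure _ _ (hH.fun_mul htail)]
  have e : ∀ z ∈ Ioi (0 : ℝ), gammaPDF (n + 1 : ℕ) r₁ z *
      (H z * gammaMeasure (m + 1 : ℕ) r₂ (Ioi z)) =
      ∑ τ ∈ Finset.range (m + 1), ENNReal.ofReal (r₁ ^ (n + 1) * r₂ ^ τ /
        (n.factorial * τ.factorial) * z ^ (n + τ) * Real.exp (-(c * y * z))) * H z := by
    intro z hz
    have hz : 0 < z := hz
    rw [gammaMeasure_Ioi m hr₂ hz.le, gammaPDF, gammaPDFReal_succ n r₁ hz.le, mul_comm (H z),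
      ← mul_assoc, ← ENNReal.ofReal_mul (by positivity), ← Finset.sum_mul,
      ← ENNReal.ofReal_sum_of_nonneg fun τ _ => by positivity, Finset.mul_sum, Finset.mul_sum]
    congr 2
    refine Finset.sum_congr rfl fun τ _ => ?_
    rw [← hcy, show -((r₁ + r₂) * z) = -(r₁ * z) + -(r₂ * z) by ring, Real.exp_add, mul_pow,
      mul_pow, pow_succ]
    field_simp
    ring
  rw [setLIntegral_congr_fun measurableSet_Ioi e, lintegral_finsetSum _ fun τ _ => by fun_prop,
    ENNReal.ofReal_sum_of_nonneg]
  · refine Finset.sum_congr rfl fun τ _ => ?_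
    rw [← lintegral_pow_exp_mul_ratio hφ hφ0 hφ1 (n + τ) (by positivity) hc hy]
    refine setLIntegral_congr_fun measurableSet_Ioi fun z hz => ?_
    rw [hHz z hz]
  · intro τ _
    have := integral_mul_inv_pow_pos hφ hφ0 hφ1 (n + τ) hy
    positivity

end Term

/-! ### The effective rate of the weak user -/

namespace NOMAParams

variable (S : NOMAParams)

lemma K_pos' : (0 : ℝ) < S.K := by exact_mod_cast S.K_pos

lemma pairBandwidth_pos : 0 < S.pairBandwidth := by
  have := S.K_pos'
  have := S.B_pos
  rw [pairBandwidth]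
  positivity

lemma ν_pos : 0 < S.ν := by
  have := S.pairBandwidth_pos
  have := S.θ_pos
  have := S.T_pos
  have := Real.log_pos one_lt_two
  rw [ν]
  positivity

lemma Ihat_pos : 0 < S.Ihat := by
  have := S.pairBandwidth_pos
  have := S.I_pos
  have := S.N₀_pos
  rw [Ihat]
  positivity

lemma Ω_pos : 0 < S.Ω := by
  have := S.Ωn_pos
  have := S.Ωf_pos
  rw [Ω]
  positivity

lemma argX_pos : 0 < S.argX := by
  have := S.K_pos'
  have := S.as_pos
  rw [argX]
  positivity

lemma argX_lt_one : S.argX < 1 := by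
  have hK := S.K_pos'
  have h1 := S.as_lt_aw
  have h2 := S.as_add_aw
  have h3 : S.as < 1 / S.K := by
    rw [show (1 : ℝ) / S.K = (2 / S.K) / 2 by ring]
    linarith
  rw [lt_div_iff₀ hK] at h3
  rw [argX]
  linarith

lemma argY_pos : 0 < S.argY := by
  have := S.K_pos'
  have := S.Ω_pos
  have := S.Ihat_pos
  have := S.Ωp_pos
  rw [argY]
  positivity

lemma ν_ne_intCast (hν : ∀ n : ℕ, S.ν ≠ n) (n : ℤ) : S.ν ≠ n := by
  intro h
  have h0 := S.ν_pos
  rw [h] at h0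
  have h1 : 0 < n := by exact_mod_cast h0
  refine hν n.toNat ?_
  rw [h]
  exact_mod_cast (Int.toNat_of_nonneg h1.le).symm

lemma isEGBMGF (hν : ∀ n : ℕ, S.ν ≠ n) {a : ℕ} (ha : 1 ≤ a) :
    IsEGBMGF (S.blk₁ a) S.blk₂ (NOMAParams.blk₃ a) S.argX S.argY
      (gFunctionValue S.ν a S.argX S.argY) :=
  isEGBMGF_gFunctionValue S.ν_pos (S.ν_ne_intCast hν) ha S.argX_pos S.argY_pos

/-- The rate `2 Î / (K Ωp)` at which the normalized gain ratio decays. -/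
def ratioRate : ℝ := 1 / S.Ωp / (S.K / (2 * S.Ihat))

lemma ratioRate_pos : 0 < S.ratioRate := by
  have := S.K_pos'
  have := S.Ihat_pos
  have := S.Ωp_pos
  rw [ratioRate]
  positivity

/-- `(1 + γ_w) ^ (-ν)` as a function of `w = K g_p / (2 Î g_w)`. -/
def ratioFun (w : ℝ) : ℝ := ((w + S.argX) / (w + 1)) ^ S.ν

lemma measurable_ratioFun : Measurable S.ratioFun := by
  unfold ratioFun
  fun_prop

lemma ratioFun_pos (w : ℝ) (hw : 0 < w) : 0 < S.ratioFun w := by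
  have := S.argX_pos
  rw [ratioFun]
  positivity

lemma ratioFun_le_one (w : ℝ) (hw : 0 < w) : S.ratioFun w ≤ 1 := by
  have := S.argX_pos
  have := S.argX_lt_one
  refine Real.rpow_le_one (by positivity) ?_ S.ν_pos.le
  rw [div_le_one (by positivity)]
  linarith

/-- `T₃` as a finite sum of real integrals. -/
def T₃Integral (n m : ℕ) (β₁ β₂ : ℝ) : ℝ :=
  ∑ τ ∈ Finset.range (m + 1),
    (1 / β₁) ^ (n + 1) * (1 / β₂) ^ τ / (n.factorial * τ.factorial) *
      (S.ratioRate ^ (n + τ + 1))⁻¹ * (n + τ + 1).factorial *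
        ∫ w in Ioi 0, S.ratioFun w * ((w + S.argY) ^ (n + τ + 2))⁻¹

lemma T₃Integral_pos (n m : ℕ) {β₁ β₂ : ℝ} (h₁ : 0 < β₁) (h₂ : 0 < β₂) :
    0 < S.T₃Integral n m β₁ β₂ := by
  refine Finset.sum_pos (fun τ _ => ?_) ⟨0, by simp⟩
  have := integral_mul_inv_pow_pos S.measurable_ratioFun S.ratioFun_pos S.ratioFun_le_one (n + τ)
    S.argY_pos
  have := S.ratioRate_pos
  positivity

/-- Non-integrality of ν makes Γ(-ν) nonzero, so Γ(ν) Γ(-ν) in the value of the G-function cancels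
against the prefactor. -/
lemma T₃_eq (hν : ∀ n : ℕ, S.ν ≠ n) (n m : ℕ) (β₁ β₂ : ℝ) :
    S.T₃ (n + 1) (m + 1) β₁ β₂ = S.T₃Integral n m β₁ β₂ := by
  have hΓ : Real.Gamma S.ν ≠ 0 := (Real.Gamma_pos_of_pos S.ν_pos).ne'
  have hΓ' : Real.Gamma (-S.ν) ≠ 0 := Real.Gamma_ne_zero fun k hk => hν k (by linarith)
  have hK := S.K_pos'
  have hI := S.Ihat_pos
  have hp := S.Ωp_pos
  rw [T₃, T₃Integral, ofReal_sum]
  refine Finset.sum_congr rfl fun τ _ => ?_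
  rw [egbmgf_eq (S.isEGBMGF hν (by lia)), ← ofReal_mul, gFunctionValue,
    show n + 1 + τ = n + τ + 1 by ring]
  congr 1
  simp only [ratioFun, ratioRate]
  push_cast
  rw [Real.Gamma_nat_eq_factorial]
  simp only [div_pow, mul_pow, one_pow]
  field_simp

end NOMAParams

/-! ### Joint law of the gains and evaluation of the expectation -/

namespace RayleighFading

variable {S : NOMAParams} {E : Type*} [MeasurableSpace E] {μ : Measure E}
  (F : RayleighFading S μ)

lemma aemeasurable_coeff (j : Unit ⊕ (Fin S.Nn ⊕ Fin S.Nf)) :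
    AEMeasurable (Sum.elim (fun _ => F.hp) (Sum.elim F.hn F.hf) j) μ := by
  rcases j with j | j | j
  · exact F.law_hp.aemeasurable
  · exact (F.law_hn j).aemeasurable
  · exact (F.law_hf j).aemeasurable

lemma γw_nonneg (ω : E) : 0 ≤ F.γw ω := by
  have h1 : 0 ≤ F.gp ω := by rw [gp]; positivity
  have h2 : 0 ≤ F.gw ω := le_min (by rw [gn]; positivity) (by rw [gf]; positivity)
  have := S.as_pos
  have := S.as_lt_aw
  have : 0 < S.aw := by linarith
  have := S.I_pos
  have := S.N₀_pos
  have := S.pairBandwidth_pos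
  rw [γw]
  positivity

lemma indepFun_gn_gf : IndepFun F.gn F.gf μ := by
  classical
  set A : Finset (Unit ⊕ (Fin S.Nn ⊕ Fin S.Nf)) := Finset.univ.image fun i => Sum.inr (Sum.inl i)
    with hA
  set B : Finset (Unit ⊕ (Fin S.Nn ⊕ Fin S.Nf)) := Finset.univ.image fun i => Sum.inr (Sum.inr i)
    with hB
  have hAi : ∀ i, Sum.inr (Sum.inl i) ∈ A := fun i => by simp [hA]
  have hBi : ∀ i, Sum.inr (Sum.inr i) ∈ B := fun i => by simp [hB]
  have h := F.indep.indepFun_finset₀ A B (by simp [hA, hB, Finset.disjoint_left])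
    F.aemeasurable_coeff
  clear_value A B
  have m1 : Measurable fun v : A → ℂ => ∑ i, ‖(√S.Ωn : ℂ) * v ⟨Sum.inr (Sum.inl i), hAi i⟩‖ ^ 2 := by
    fun_prop
  have m2 : Measurable fun v : B → ℂ => ∑ i, ‖(√S.Ωf : ℂ) * v ⟨Sum.inr (Sum.inr i), hBi i⟩‖ ^ 2 := by
    fun_prop
  exact h.comp m1 m2

lemma indepFun_gp_gn_gf : IndepFun F.gp (fun ω => (F.gn ω, F.gf ω)) μ := by
  classical
  set A : Finset (Unit ⊕ (Fin S.Nn ⊕ Fin S.Nf)) := {Sum.inl ()} with hA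
  set B : Finset (Unit ⊕ (Fin S.Nn ⊕ Fin S.Nf)) := Finset.univ.image Sum.inr with hB
  have hAi : Sum.inl () ∈ A := by simp [hA]
  have hBi : ∀ i, Sum.inr i ∈ B := fun i => by simp [hB]
  have h := F.indep.indepFun_finset₀ A B (by simp [hA, hB]) F.aemeasurable_coeff
  clear_value A B
  have m1 : Measurable fun v : A → ℂ => ‖(√S.Ωp : ℂ) * v ⟨Sum.inl (), hAi⟩‖ ^ 2 := by
    fun_prop
  have m2 : Measurable fun v : B → ℂ =>
      (∑ i, ‖(√S.Ωn : ℂ) * v ⟨Sum.inr (Sum.inl i), hBi _⟩‖ ^ 2,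
        ∑ i, ‖(√S.Ωf : ℂ) * v ⟨Sum.inr (Sum.inr i), hBi _⟩‖ ^ 2) := by
    fun_prop
  exact h.comp m1 m2

variable [IsProbabilityMeasure μ]

lemma hasLaw_gp : HasLaw F.gp (gammaMeasure (1 : ℕ) (1 / S.Ωp)) μ := by
  have h := hasLaw_sum_gain (ι := Unit) (h := fun _ => F.hp) (P := μ) (fun _ => F.law_hp)
    (F.indep.precomp (g := fun _ : Unit => Sum.inl ()) fun _ _ _ => rfl) S.Ωp_pos (N := 1)
    (by simp) le_rfl
  simp only [Finset.univ_unique, Finset.sum_singleton] at h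
  exact h

lemma hasLaw_gn : HasLaw F.gn (gammaMeasure S.Nn (1 / S.Ωn)) μ :=
  hasLaw_sum_gain F.law_hn
    (F.indep.precomp (g := fun i => Sum.inr (Sum.inl i)) fun i j h => by simpa using h) S.Ωn_pos
    (by simp) S.Nn_pos

lemma hasLaw_gf : HasLaw F.gf (gammaMeasure S.Nf (1 / S.Ωf)) μ :=
  hasLaw_sum_gain F.law_hf
    (F.indep.precomp (g := fun i => Sum.inr (Sum.inr i)) fun i j h => by simpa using h) S.Ωf_pos
    (by simp) S.Nf_pos

/-- Since a_s + a_w = 2/K, one has 1 + γ_w = (w + 1)/(w + x); both user coefficients survive only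
through x. -/
lemma rate_integrand_eq {p z : ℝ} (hp : 0 < p) (hz : 0 < z) :
    (1 + S.aw * S.I * z / p / (S.N₀ * S.pairBandwidth + S.as * S.I * z / p)) ^ (-S.ν) =
      S.ratioFun (S.K / (2 * S.Ihat) * p / z) := by
  have hK := S.K_pos'
  have hI := S.I_pos
  have hN := S.N₀_pos
  have hB := S.pairBandwidth_pos
  have has := S.as_pos
  have hIh := S.Ihat_pos
  have haw : S.aw = 2 / S.K - S.as := by linarith [S.as_add_aw]
  have hX := S.argX_pos
  set w := S.K / (2 * S.Ihat) * p / z with hw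
  have hw0 : 0 < w := by positivity
  have e : 1 + S.aw * S.I * z / p / (S.N₀ * S.pairBandwidth + S.as * S.I * z / p) =
      ((w + S.argX) / (w + 1))⁻¹ := by
    have d1 : 0 < S.N₀ * S.pairBandwidth + S.as * S.I * z / p := by positivity
    have d2 : 0 < w + S.argX := by positivity
    rw [inv_div, eq_div_iff d2.ne', one_add_div d1.ne', div_mul_eq_mul_div, div_eq_iff d1.ne', haw,
      hw, NOMAParams.argX, NOMAParams.Ihat]
    field_simp
    ring
  rw [e, Real.inv_rpow (by positivity), Real.rpow_neg (by positivity), inv_inv]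
  rfl

lemma lintegral_rate :
    ∫⁻ ω, ENNReal.ofReal ((1 + F.γw ω) ^ (-S.ν)) ∂μ =
      ENNReal.ofReal (S.T₃Integral (S.Nn - 1) (S.Nf - 1) S.Ωn S.Ωf +
        S.T₃Integral (S.Nf - 1) (S.Nn - 1) S.Ωf S.Ωn) := by
  obtain ⟨n, hn⟩ : ∃ n, S.Nn = n + 1 := ⟨S.Nn - 1, by have := S.Nn_pos; lia⟩
  obtain ⟨m, hm⟩ : ∃ m, S.Nf = m + 1 := ⟨S.Nf - 1, by have := S.Nf_pos; lia⟩
  have hΩn := S.Ωn_pos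
  have hΩf := S.Ωf_pos
  have hΩp := S.Ωp_pos
  have hK := S.K_pos'
  have hIh := S.Ihat_pos
  have hrn : 0 < 1 / S.Ωn := by positivity
  have hrf : 0 < 1 / S.Ωf := by positivity
  have hrp : 0 < 1 / S.Ωp := by positivity
  have hgn := F.hasLaw_gn
  have hgf := F.hasLaw_gf
  rw [hn] at hgn
  rw [hm] at hgf
  have i1 : IsProbabilityMeasure (gammaMeasure (n + 1 : ℕ) (1 / S.Ωn)) :=
    isProbabilityMeasure_gammaMeasure (by positivity) hrn
  have i2 : IsProbabilityMeasure (gammaMeasure (m + 1 : ℕ) (1 / S.Ωf)) :=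
    isProbabilityMeasure_gammaMeasure (by positivity) hrf
  have i3 : IsProbabilityMeasure (gammaMeasure (1 : ℕ) (1 / S.Ωp)) :=
    isProbabilityMeasure_gammaMeasure (by positivity) hrp
  have hjoint := F.indepFun_gp_gn_gf.hasLaw_prod F.hasLaw_gp (F.indepFun_gn_gf.hasLaw_prod hgn hgf)
  set Ψ : ℝ × ℝ → ENNReal := fun q => ENNReal.ofReal
    ((1 + S.aw * S.I * q.2 / q.1 / (S.N₀ * S.pairBandwidth + S.as * S.I * q.2 / q.1)) ^ (-S.ν))
    with hΨ
  have hΨm : Measurable Ψ := by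
    simp only [hΨ]
    fun_prop
  set H : ℝ → ENNReal := fun z => ∫⁻ p, Ψ (p, z) ∂gammaMeasure (1 : ℕ) (1 / S.Ωp) with hH
  have hHm : Measurable H := hΨm.lintegral_prod_left'
  have hΨ' : Measurable fun q : ℝ × ℝ × ℝ => Ψ (q.1, min q.2.1 q.2.2) := by fun_prop
  have h1 : ∫⁻ ω, ENNReal.ofReal ((1 + F.γw ω) ^ (-S.ν)) ∂μ =
      ∫⁻ q, Ψ (q.1, min q.2.1 q.2.2) ∂((gammaMeasure (1 : ℕ) (1 / S.Ωp)).prod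
        ((gammaMeasure (n + 1 : ℕ) (1 / S.Ωn)).prod (gammaMeasure (m + 1 : ℕ) (1 / S.Ωf)))) := by
    rw [← hjoint.lintegral_comp hΨ'.aemeasurable]
    rfl
  have hHz : ∀ z, 0 < z → H z = ∫⁻ w in Ioi 0,
      ENNReal.ofReal (S.ratioRate * z * Real.exp (-(S.ratioRate * z * w))) *
        ENNReal.ofReal (S.ratioFun w) := by
    intro z hz
    refine lintegral_exp_ratio (κ := S.K / (2 * S.Ihat)) (by positivity) hz
      (g := fun w => ENNReal.ofReal (S.ratioFun w)) (by fun_prop) fun p hp => ?_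
    simp only [hΨ]
    rw [rate_integrand_eq hp hz]
  -- Both sides are 1/Ω: the second argument of the G-function is the total decay rate of the two
  -- user gains, rescaled by the rate of w.
  have hcy : 1 / S.Ωn + 1 / S.Ωf = S.ratioRate * S.argY := by
    rw [NOMAParams.ratioRate, NOMAParams.argY, NOMAParams.Ω]
    field_simp
    ring
  rw [h1, lintegral_prod_symm' _ hΨ']
  -- Once the interference gain is integrated out, the integrand depends on the two user gains only
  -- through their minimum.
  change ∫⁻ p : ℝ × ℝ, H (min p.1 p.2) ∂_ = _
  rw [lintegral_min_prod _ _ hHm]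
  simp only [gammaMeasure_Ici]
  rw [lintegral_mul_gammaMeasure_Ioi S.measurable_ratioFun S.ratioFun_pos S.ratioFun_le_one n m
      hrn hrf S.ratioRate_pos S.argY_pos hcy hHm hHz,
    lintegral_mul_gammaMeasure_Ioi S.measurable_ratioFun S.ratioFun_pos S.ratioFun_le_one m n
      hrf hrn S.ratioRate_pos S.argY_pos (by rw [add_comm, hcy]) hHm hHz]
  change ENNReal.ofReal (S.T₃Integral n m _ _) + ENNReal.ofReal (S.T₃Integral m n _ _) = _
  rw [← ENNReal.ofReal_add (S.T₃Integral_pos n m hΩn hΩf).le (S.T₃Integral_pos m n hΩf hΩn).le, hn, hm]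
  rfl

lemma integral_rate :
    ∫ ω, (1 + F.γw ω) ^ (-S.ν) ∂μ = S.T₃Integral (S.Nn - 1) (S.Nf - 1) S.Ωn S.Ωf +
        S.T₃Integral (S.Nf - 1) (S.Nn - 1) S.Ωf S.Ωn := by
  have m1 := F.hasLaw_gp.aemeasurable
  have m2 := F.hasLaw_gn.aemeasurable
  have m3 := F.hasLaw_gf.aemeasurable
  rw [integral_eq_lintegral_of_nonneg_ae, F.lintegral_rate, ENNReal.toReal_ofReal]
  · exact (add_pos (S.T₃Integral_pos _ _ S.Ωn_pos S.Ωf_pos)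
      (S.T₃Integral_pos _ _ S.Ωf_pos S.Ωn_pos)).le
  · refine ae_of_all _ fun ω => ?_
    have := F.γw_nonneg ω
    simp only [Pi.zero_apply]
    positivity
  · have : AEMeasurable F.gw μ := m2.min m3
    have : AEMeasurable F.γw μ := by
      unfold γw
      fun_prop
    exact AEMeasurable.aestronglyMeasurable (by fun_prop)

end RayleighFading

end

theorem theorem2 (S : NOMAParams) (hν : ∀ n : ℕ, S.ν ≠ n)
    {E : Type*} [MeasurableSpace E] (μ : Measure E) [IsProbabilityMeasure μ]
    (F : RayleighFading S μ) :
    (∀ τ < S.Nf, ∃ v, IsEGBMGF (S.blk₁ (S.Nn + τ)) S.blk₂ (NOMAParams.blk₃ (S.Nn + τ)) S.argX S.argY v) ∧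
    (∀ τ < S.Nn, ∃ v, IsEGBMGF (S.blk₁ (S.Nf + τ)) S.blk₂ (NOMAParams.blk₃ (S.Nf + τ)) S.argX S.argY v) ∧
    (S.T₃ S.Nn S.Nf S.Ωn S.Ωf).im = 0 ∧ (S.T₃ S.Nf S.Nn S.Ωf S.Ωn).im = 0 ∧
    0 < (S.T₃ S.Nn S.Nf S.Ωn S.Ωf + S.T₃ S.Nf S.Nn S.Ωf S.Ωn).re ∧
    F.Rw = -1 / S.ν *
      Real.logb 2 (S.T₃ S.Nn S.Nf S.Ωn S.Ωf + S.T₃ S.Nf S.Nn S.Ωf S.Ωn).re := by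
  have hn := S.Nn_pos
  have hf := S.Nf_pos
  have e1 : S.T₃ S.Nn S.Nf S.Ωn S.Ωf = S.T₃Integral (S.Nn - 1) (S.Nf - 1) S.Ωn S.Ωf := by
    rw [← S.T₃_eq hν, Nat.sub_add_cancel hn, Nat.sub_add_cancel hf]
  have e2 : S.T₃ S.Nf S.Nn S.Ωf S.Ωn = S.T₃Integral (S.Nf - 1) (S.Nn - 1) S.Ωf S.Ωn := by
    rw [← S.T₃_eq hν, Nat.sub_add_cancel hn, Nat.sub_add_cancel hf]
  refine ⟨fun τ _ => ⟨_, S.isEGBMGF hν (by lia)⟩, fun τ _ => ⟨_, S.isEGBMGF hν (by lia)⟩, ?_⟩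
  rw [e1, e2, ← Complex.ofReal_add, Complex.ofReal_re, RayleighFading.Rw, F.integral_rate]
  exact ⟨Complex.ofReal_im _, Complex.ofReal_im _, add_pos
    (S.T₃Integral_pos _ _ S.Ωn_pos S.Ωf_pos) (S.T₃Integral_pos _ _ S.Ωf_pos S.Ωn_pos), rfl⟩
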